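/- A touching triangle representation of a finite simple graph $G=(V,E)$ assigns to every vertex $v\in V$ a nondegenerate closed triangle $T_v$ in the Euclidean plane such that the triangles of distinct vertices have disjoint interiors, and such that two distinct vertices $u,v$ are adjacent in $G$ if and only if $T_u$ and $T_v$ touch non-trivially, that is, some side of $T_u$ and some side of $T_v$ have a line segment of positive length in common (sharing only a point does not count). A graph is a touching triangle graph if it has such a representation. Theorem. Let $G$ be a touching triangle graph and let $u\neq v$ be any two distinct vertices of $G$, adjacent or not. Let $N_{uv}$ be the set of common neighbours of $u$ and $v$, and let $E_{uv}$ be the set of edges of $G$ with both endpoints in $N_{uv}$. Then $|N_{uv}|\le 4$ and $|E_{uv}|\le 2$. -/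

import Mathlib

namespace TouchingTriangles

/-- The Euclidean plane. -/
abbrev Plane : Type := EuclideanSpace ℝ (Fin 2)

/-- The closed triangular region spanned by a (nondegenerate) triangle. -/
def region (T : Affine.Triangle ℝ Plane) : Set Plane :=
  convexHull ℝ (Set.range T.points)

/-- The side of `T` joining the vertices numbered `i` and `i + 1` (modulo 3). -/
def side (T : Affine.Triangle ℝ Plane) (i : Fin 3) : Set Plane :=
  segment ℝ (T.points i) (T.points (i + 1))

/-- Two triangles touch non-trivially: some side of one and some side of the other
have a line segment of positive length in common. -/
def Touch (A B : Affine.Triangle ℝ Plane) : Prop :=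
  ∃ i j : Fin 3, ∃ p q : Plane, p ≠ q ∧ segment ℝ p q ⊆ side A i ∩ side B j

/-- `T` is a touching triangle representation of `G`: the triangles of distinct vertices do not
overlap (so that `T` is automatically injective, that is, a bijection of the vertices onto a set
of triangles), and they touch non-trivially exactly when the vertices are adjacent. -/
structure IsRepresentation {V : Type*} (G : SimpleGraph V)
    (T : V → Affine.Triangle ℝ Plane) : Prop where
  disjoint_interior : ∀ u v : V, u ≠ v → Disjoint (interior (region (T u))) (interior (region (T v)))
  adj_iff_touch : ∀ u v : V, u ≠ v → (G.Adj u v ↔ Touch (T u) (T v))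

/-- Touching triangle graphs: graphs that have a touching triangle representation. -/
def IsTouchingTriangleGraph {V : Type*} (G : SimpleGraph V) : Prop :=
  ∃ T : V → Affine.Triangle ℝ Plane, IsRepresentation G T

end TouchingTriangles

namespace TouchingTriangles

/-! Count the ends of contacts. The intersection of two adjacent triangles lies on a separating
line. A functional `f` that is constant on none of these intersections gives each a lower and an
upper end, so `K` contacts have `2|K|` ends.

At a point `p`, a level line of `f` just above `p` cuts the triangles that reach upward from `p` in
nonoverlapping intervals. Contacts with lower end `p` become touching pairs of intervals, so they
are fewer than these triangles (`card_contacts_le`); the same holds below. If a contact ends at `p`,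
at most one triangle through `p` has no vertex there (`card_flat_le_one`), and the savings of one
above and below absorb it. Hence the ends at `p` number at most the triangle vertices at `p` plus
the middle vertices at `p`, where middle refers to the order of `f` (`card_ends_le_add_mid`). At an
exposed point of the union everything lies on one side, so the ends are even fewer than the vertices
(`Exposed.card_ends_lt`), and three such points exist. For `n` triangles this sums to `2|K| + 3 ≤ 3n
+ n`. Taking `n = |N| + 2` and `|K| = 2|N| + |E|` gives `|E| ≤ 2`.

For `|N| ≤ 4`, keep only the contacts between `{u, v}` and `N`. The ends at a point are then at most
the vertices there, with an excess of one only where two members of `N` both have contacts with `u`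
and with `v` ending (`card_ends_le_of_bipartite`). At most one point is of this kind
(`eq_of_two_le_card_inter`), whence `4|N| + 3 ≤ 3(|N| + 2) + 1`. -/

/-! ### Linear functionals on the plane -/

/-- The linear functional on the plane with coefficients `a` and `b`. -/
def functional (a b : ℝ) : Plane →ₗ[ℝ] ℝ where
  toFun z := a * z 0 + b * z 1
  map_add' x y := by simp; ring
  map_smul' c x := by simp; ring

@[simp] lemma functional_apply (a b : ℝ) (z : Plane) : functional a b z = a * z 0 + b * z 1 := rfl

lemma exists_eq_functional (f : Plane →ₗ[ℝ] ℝ) : ∃ a b, f = functional a b := by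
  refine ⟨f (EuclideanSpace.single 0 1), f (EuclideanSpace.single 1 1), LinearMap.ext fun z => ?_⟩
  have hz : z = z 0 • EuclideanSpace.single 0 (1 : ℝ) + z 1 • EuclideanSpace.single 1 (1 : ℝ) := by
    ext i; fin_cases i <;> simp
  conv_lhs => rw [hz]
  simp [mul_comm]

lemma functional_ne_zero_iff {a b : ℝ} : functional a b ≠ 0 ↔ a ≠ 0 ∨ b ≠ 0 := by
  constructor
  · intro h
    by_contra! hab
    exact h (LinearMap.ext fun z => by simp [hab.1, hab.2])
  · rintro (h | h) h0
    · exact h (by simpa using LinearMap.congr_fun h0 (EuclideanSpace.single 0 1))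
    · exact h (by simpa using LinearMap.congr_fun h0 (EuclideanSpace.single 1 1))

lemma plane_ne_zero {w : Plane} (hw : w ≠ 0) : w 0 ≠ 0 ∨ w 1 ≠ 0 := by
  by_contra! h
  exact hw (by ext i; fin_cases i <;> simp [h.1, h.2])

/-- Two functionals on the plane with a common nonzero kernel vector are proportional. -/
lemma exists_eq_smul {f h : Plane →ₗ[ℝ] ℝ} {w : Plane} (hw : w ≠ 0) (hf : f ≠ 0)
    (hfw : f w = 0) (hhw : h w = 0) : ∃ α : ℝ, h = α • f := by
  obtain ⟨a, b, rfl⟩ := exists_eq_functional f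
  obtain ⟨a', b', rfl⟩ := exists_eq_functional h
  simp only [functional_apply] at hfw hhw
  have hdet : a * b' = a' * b := by
    rcases plane_ne_zero hw with h0 | h1
    · apply mul_left_cancel₀ h0; linear_combination b' * hfw - b * hhw
    · apply mul_left_cancel₀ h1; linear_combination a * hhw - a' * hfw
  rcases functional_ne_zero_iff.1 hf with ha | hb
  · refine ⟨a' / a, LinearMap.ext fun z => ?_⟩
    simp only [functional_apply, LinearMap.smul_apply, smul_eq_mul]
    field_simp
    linear_combination z 1 * hdet
  · refine ⟨b' / b, LinearMap.ext fun z => ?_⟩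
    simp only [functional_apply, LinearMap.smul_apply, smul_eq_mul]
    field_simp
    linear_combination -z 0 * hdet

/-- Vectors of the plane killed by a common nonzero functional are proportional. -/
lemma exists_vector_eq_smul {f : Plane →ₗ[ℝ] ℝ} (hf : f ≠ 0) {v w : Plane} (hv : v ≠ 0)
    (hfv : f v = 0) (hfw : f w = 0) : ∃ t : ℝ, w = t • v := by
  obtain ⟨a, b, rfl⟩ := exists_eq_functional f
  simp only [functional_apply] at hfv hfw
  have hdet : v 0 * w 1 = v 1 * w 0 := by
    rcases functional_ne_zero_iff.1 hf with h0 | h1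
    · apply mul_left_cancel₀ h0; linear_combination w 1 * hfv - v 1 * hfw
    · apply mul_left_cancel₀ h1; linear_combination v 0 * hfw - w 0 * hfv
  rcases plane_ne_zero hv with h | h
  · refine ⟨w 0 / v 0, ?_⟩
    ext i; fin_cases i
    · simp [h]
    · simp only [Fin.mk_one, PiLp.smul_apply, smul_eq_mul]; field_simp; linear_combination hdet
  · refine ⟨w 1 / v 1, ?_⟩
    ext i; fin_cases i
    · simp only [Fin.zero_eta, PiLp.smul_apply, smul_eq_mul]; field_simp; linear_combination -hdet
    · simp [h]

lemma exists_functional_vanishing {w : Plane} (hw : w ≠ 0) :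
    ∃ h : Plane →ₗ[ℝ] ℝ, h ≠ 0 ∧ h w = 0 :=
  ⟨functional (-w 1) (w 0),
    functional_ne_zero_iff.2 ((plane_ne_zero hw).symm.imp (fun h => by simpa using h) id),
    by simp; ring⟩

lemma exists_complementary {f : Plane →ₗ[ℝ] ℝ} (hf : f ≠ 0) :
    ∃ g : Plane →ₗ[ℝ] ℝ, ∀ z, f z = 0 → g z = 0 → z = 0 := by
  obtain ⟨a, b, rfl⟩ := exists_eq_functional f
  refine ⟨functional (-b) a, fun z h1 h2 => ?_⟩
  simp only [functional_apply] at h1 h2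
  have hpos : a ^ 2 + b ^ 2 ≠ 0 := by
    rcases functional_ne_zero_iff.1 hf with h | h <;> positivity
  ext i; fin_cases i
  · exact (mul_eq_zero.1 (show (a ^ 2 + b ^ 2) * z 0 = 0 by
      linear_combination a * h1 - b * h2)).resolve_left hpos
  · exact (mul_eq_zero.1 (show (a ^ 2 + b ^ 2) * z 1 = 0 by
      linear_combination b * h1 + a * h2)).resolve_left hpos

/-! ### Separated convex bodies and flat points -/

/-- Two sets lie on different sides of a line. -/
def Separated (X Y : Set Plane) : Prop :=
  ∃ (h : Plane →ₗ[ℝ] ℝ) (c : ℝ), h ≠ 0 ∧ (∀ x ∈ X, h x ≤ c) ∧ ∀ y ∈ Y, c ≤ h y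

lemma Separated.symm {X Y : Set Plane} (h : Separated X Y) : Separated Y X := by
  obtain ⟨h, c, h0, hX, hY⟩ := h
  exact ⟨-h, -c, neg_ne_zero.2 h0, fun y hy => by simpa using hY y hy,
    fun x hx => by simpa using hX x hx⟩

/-- A convex body in the plane: compact, convex and not contained in a line. -/
structure IsBody (X : Set Plane) : Prop where
  convex : Convex ℝ X
  compact : IsCompact X
  solid : ∀ h : Plane →ₗ[ℝ] ℝ, h ≠ 0 → ∀ c, ∃ x ∈ X, h x ≠ c

lemma interior_region_nonempty (T : Affine.Triangle ℝ Plane) : (interior (region T)).Nonempty := by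
  rw [region, interior_convexHull_nonempty_iff_affineSpan_eq_top,
    T.independent.affineSpan_eq_top_iff_card_eq_finrank_add_one]
  simp

lemma isCompact_region (T : Affine.Triangle ℝ Plane) : IsCompact (region T) :=
  (Set.finite_range _).isCompact_convexHull ℝ

lemma convex_region (T : Affine.Triangle ℝ Plane) : Convex ℝ (region T) := convex_convexHull ℝ _

lemma isBody_region (T : Affine.Triangle ℝ Plane) : IsBody (region T) where
  convex := convex_region T
  compact := isCompact_region T
  solid h h0 c := by
    by_contra! hc
    obtain ⟨x, hx⟩ := interior_region_nonempty T
    apply h0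
    ext1 v
    have hcont : Filter.Tendsto (fun t : ℝ => x + t • v) (nhds 0) (nhds x) := by
      have : Continuous fun t : ℝ => x + t • v := by fun_prop
      simpa using this.tendsto 0
    have hev := hcont.eventually (isOpen_interior.mem_nhds hx)
    obtain ⟨t, ht, ht0⟩ :=
      ((hev.filter_mono nhdsWithin_le_nhds).and (self_mem_nhdsWithin (a := (0 : ℝ)) (s := {0}ᶜ))).exists
    have h1 := hc _ (interior_subset ht)
    have h2 := hc _ (interior_subset hx)
    rw [map_add, h2, map_smul, smul_eq_mul] at h1
    have : t * h v = 0 := by linarith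
    simpa using (mul_eq_zero.1 this).resolve_left ht0

/-- Hahn–Banach separates the open interiors; the inequalities pass to the closures, which are the
regions. -/
lemma separated_region {S T : Affine.Triangle ℝ Plane}
    (h : Disjoint (interior (region S)) (interior (region T))) :
    Separated (region S) (region T) := by
  have hcl : ∀ T : Affine.Triangle ℝ Plane, closure (interior (region T)) = region T := fun T => by
    rw [(convex_region T).closure_interior_eq_closure_of_nonempty_interior
      (interior_region_nonempty T), (isCompact_region T).isClosed.closure_eq]
  obtain ⟨f, c, hS, hT⟩ := geometric_hahn_banach_open (convex_region S).interior isOpen_interior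
    (convex_region T).interior h
  have hSc : ∀ x ∈ region S, f x ≤ c := by
    rw [← hcl S]
    exact fun x hx => closure_minimal (fun y hy => (hS y hy).le)
      (isClosed_le f.continuous continuous_const) hx
  have hTc : ∀ x ∈ region T, c ≤ f x := by
    rw [← hcl T]
    exact fun x hx => closure_minimal (fun y hy => hT y hy)
      (isClosed_le continuous_const f.continuous) hx
  refine ⟨f, c, ?_, hSc, hTc⟩
  intro h0
  obtain ⟨x, hx⟩ := interior_region_nonempty S
  obtain ⟨y, hy⟩ := interior_region_nonempty T
  have e : ∀ z, f z = 0 := fun z => LinearMap.congr_fun h0 z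
  have h1 := hS x hx
  have h2 := hT y hy
  rw [e] at h1 h2
  linarith

/-- A linear functional that attains its maximum inside a segment is constant on it. So a separating
line through a flat point must follow the segment there. -/
lemma eq_of_mem_openSegment {X : Set Plane} {h : Plane →ₗ[ℝ] ℝ} {c : ℝ} {p a b : Plane}
    (hX : ∀ x ∈ X, h x ≤ c) (ha : a ∈ X) (hb : b ∈ X) (hp : p ∈ openSegment ℝ a b)
    (hc : h p = c) : h (b - a) = 0 := by
  obtain ⟨s, t, hs, ht, hst, rfl⟩ := hp
  have h1 := hX a ha
  have h2 := hX b hb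
  simp only [map_add, map_smul, smul_eq_mul] at hc
  have hs' : s = 1 - t := by linarith
  subst hs'
  have e1 : h a = c := le_antisymm h1 (by nlinarith)
  have e2 : h b = c := le_antisymm h2 (by nlinarith)
  simp [e1, e2]

/-- Three bodies through a point cannot be separated in pairs by parallel lines. -/
lemma not_three_parallel {X Y Z : Set Plane} (hX : IsBody X) (hY : IsBody Y) (hZ : IsBody Z)
    {p d : Plane} (hd : d ≠ 0) (hpX : p ∈ X) (hpY : p ∈ Y) (hpZ : p ∈ Z)
    {h₁ h₂ h₃ : Plane →ₗ[ℝ] ℝ} {c₁ c₂ c₃ : ℝ} (n₁ : h₁ ≠ 0) (n₂ : h₂ ≠ 0) (n₃ : h₃ ≠ 0)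
    (X₁ : ∀ x ∈ X, h₁ x ≤ c₁) (Y₁ : ∀ y ∈ Y, c₁ ≤ h₁ y)
    (X₂ : ∀ x ∈ X, h₂ x ≤ c₂) (Z₂ : ∀ z ∈ Z, c₂ ≤ h₂ z)
    (Y₃ : ∀ y ∈ Y, h₃ y ≤ c₃) (Z₃ : ∀ z ∈ Z, c₃ ≤ h₃ z)
    (d₁ : h₁ d = 0) (d₂ : h₂ d = 0) (d₃ : h₃ d = 0) : False := by
  obtain ⟨α, rfl⟩ := exists_eq_smul hd n₁ d₁ d₂
  obtain ⟨β, rfl⟩ := exists_eq_smul hd n₁ d₁ d₃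
  have e₁ : h₁ p = c₁ := le_antisymm (X₁ p hpX) (Y₁ p hpY)
  have e₂ := le_antisymm (X₂ p hpX) (Z₂ p hpZ)
  have e₃ := le_antisymm (Y₃ p hpY) (Z₃ p hpZ)
  simp only [LinearMap.smul_apply, smul_eq_mul] at *
  subst e₁ e₂ e₃
  have hα : α ≠ 0 := by rintro rfl; simp at n₂
  have hβ : β ≠ 0 := by rintro rfl; simp at n₃
  obtain ⟨x, hx, hx'⟩ := hX.solid h₁ n₁ (h₁ p)
  obtain ⟨y, hy, hy'⟩ := hY.solid h₁ n₁ (h₁ p)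
  obtain ⟨z, hz, hz'⟩ := hZ.solid h₁ n₁ (h₁ p)
  have x1 := lt_of_le_of_ne (X₁ x hx) hx'
  have y1 := lt_of_le_of_ne (Y₁ y hy) hy'.symm
  -- `X` lies below the line and `Y` above it, which fixes the signs of `α` and `β`. Then `Z` is
  -- confined to both sides, hence to the line.
  have α0 : 0 < α := lt_of_le_of_ne (by by_contra! h; nlinarith [X₂ x hx]) hα.symm
  have β0 : β < 0 := lt_of_le_of_ne (by by_contra! h; nlinarith [Y₃ y hy]) hβ
  have z2 := le_of_mul_le_mul_left (Z₂ z hz) α0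
  have z3 : h₁ z ≤ h₁ p := by by_contra! h; nlinarith [Z₃ z hz]
  exact hz' (le_antisymm z3 z2)

/-- No three bodies share a segment. -/
lemma not_three_share {X Y Z : Set Plane} (hX : IsBody X) (hY : IsBody Y) (hZ : IsBody Z)
    (hXY : Separated X Y) (hXZ : Separated X Z) (hYZ : Separated Y Z)
    {a b : Plane} (hab : a ≠ b) (haX : a ∈ X) (hbX : b ∈ X) (haY : a ∈ Y) (hbY : b ∈ Y)
    (haZ : a ∈ Z) (hbZ : b ∈ Z) : False := by
  obtain ⟨h₁, c₁, n₁, X₁, Y₁⟩ := hXY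
  obtain ⟨h₂, c₂, n₂, X₂, Z₂⟩ := hXZ
  obtain ⟨h₃, c₃, n₃, Y₃, Z₃⟩ := hYZ
  refine not_three_parallel hX hY hZ (sub_ne_zero.2 hab) haX haY haZ n₁ n₂ n₃ X₁ Y₁ X₂ Z₂ Y₃ Z₃
    ?_ ?_ ?_
  · rw [map_sub]
    linarith [X₁ a haX, X₁ b hbX, Y₁ a haY, Y₁ b hbY]
  · rw [map_sub]
    linarith [X₂ a haX, X₂ b hbX, Z₂ a haZ, Z₂ b hbZ]
  · rw [map_sub]
    linarith [Y₃ a haY, Y₃ b hbY, Z₃ a haZ, Z₃ b hbZ]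

/-- A point through which a segment of `X` passes. -/
def IsFlat (X : Set Plane) (p : Plane) : Prop :=
  ∃ a ∈ X, ∃ b ∈ X, a ≠ b ∧ p ∈ openSegment ℝ a b

lemma IsFlat.mem {X : Set Plane} (hX : IsBody X) {p : Plane} (h : IsFlat X p) : p ∈ X := by
  obtain ⟨a, ha, b, hb, -, hp⟩ := h
  exact hX.convex.openSegment_subset ha hb hp

/-- The line separating `X` from `Y` follows both flat segments, so these are parallel. The other
two separating lines each follow one of them, so all three lines coincide. -/
lemma not_three_flat {X Y Z : Set Plane} (hX : IsBody X) (hY : IsBody Y) (hZ : IsBody Z)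
    (hXY : Separated X Y) (hXZ : Separated X Z) (hYZ : Separated Y Z) {p : Plane}
    (fX : IsFlat X p) (fY : IsFlat Y p) (hpZ : p ∈ Z) : False := by
  have hpX := fX.mem hX
  have hpY := fY.mem hY
  obtain ⟨a, ha, b, hb, hab, hp⟩ := fX
  obtain ⟨a', ha', b', hb', hab', hp'⟩ := fY
  obtain ⟨h₁, c₁, n₁, X₁, Y₁⟩ := hXY
  obtain ⟨h₂, c₂, n₂, X₂, Z₂⟩ := hXZ
  obtain ⟨h₃, c₃, n₃, Y₃, Z₃⟩ := hYZ
  have hd := sub_ne_zero.2 hab.symm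
  have d₁ := eq_of_mem_openSegment X₁ ha hb hp (le_antisymm (X₁ p hpX) (Y₁ p hpY))
  have d₂ := eq_of_mem_openSegment X₂ ha hb hp (le_antisymm (X₂ p hpX) (Z₂ p hpZ))
  have d₃ := eq_of_mem_openSegment Y₃ ha' hb' hp' (le_antisymm (Y₃ p hpY) (Z₃ p hpZ))
  have d₁' : h₁ (b' - a') = 0 := by
    have := eq_of_mem_openSegment (h := -h₁) (c := -c₁) (fun y hy => by simpa using Y₁ y hy)
      ha' hb' hp' (by simp [le_antisymm (X₁ p hpX) (Y₁ p hpY)])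
    rwa [LinearMap.neg_apply, neg_eq_zero] at this
  obtain ⟨t, ht⟩ := exists_vector_eq_smul n₁ hd d₁ d₁'
  refine not_three_parallel hX hY hZ hd hpX hpY hpZ n₁ n₂ n₃ X₁ Y₁ X₂ Z₂ Y₃ Z₃ d₁ d₂ ?_
  rw [ht, map_smul, smul_eq_mul] at d₃
  refine (mul_eq_zero.1 d₃).resolve_left ?_
  rintro rfl
  exact hab' (by simpa [sub_eq_zero, eq_comm] using ht)

lemma mem_of_le {X : Set Plane} (hX : Convex ℝ X) {p d : Plane} {s t : ℝ} (hp : p ∈ X)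
    (hs : 0 ≤ s) (hst : s ≤ t) (h : p + t • d ∈ X) : p + s • d ∈ X := by
  rcases hs.eq_or_lt with rfl | hs
  · simpa using hp
  have ht : 0 < t := hs.trans_le hst
  have := hX.add_smul_mem hp h (t := s / t) ⟨by positivity, (div_le_one ht).2 hst⟩
  rwa [smul_smul, div_mul_cancel₀ _ ht.ne'] at this

lemma IsFlat.exists_smul {X : Set Plane} {p : Plane} (hX : Convex ℝ X) (h : IsFlat X p) :
    ∃ d : Plane, d ≠ 0 ∧ (∃ a ∈ X, ∃ b ∈ X, p ∈ openSegment ℝ a b ∧ d = b - a) ∧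
      ∃ ε > 0, p + (ε : ℝ) • d ∈ X ∧ p - (ε : ℝ) • d ∈ X := by
  obtain ⟨a, ha, b, hb, hab, hp⟩ := h
  refine ⟨b - a, sub_ne_zero.2 hab.symm, ⟨a, ha, b, hb, hp, rfl⟩, ?_⟩
  have hpX := hX.openSegment_subset ha hb hp
  obtain ⟨s, t, hs, ht, hst, rfl⟩ := hp
  have hb' : s • a + t • b + s • (b - a) = b := by
    obtain rfl : t = 1 - s := by linarith
    module
  have ha' : s • a + t • b + t • -(b - a) = a := by
    obtain rfl : t = 1 - s := by linarith
    module
  refine ⟨min s t, lt_min hs ht, mem_of_le hX hpX (lt_min hs ht).le (min_le_left _ _) (by rwa [hb']), ?_⟩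
  rw [sub_eq_add_neg, ← smul_neg]
  exact mem_of_le hX hpX (lt_min hs ht).le (min_le_right _ _) (by rwa [ha'])

/-- Both flat segments follow the separating line, so they overlap in a segment around `p`. -/
lemma isFlat_inter {X Y : Set Plane} (hX : IsBody X) (hY : IsBody Y) (hXY : Separated X Y)
    {p : Plane} (fX : IsFlat X p) (fY : IsFlat Y p) : IsFlat (X ∩ Y) p := by
  have hpX := fX.mem hX
  have hpY := fY.mem hY
  obtain ⟨d, d0, ⟨a, ha, b, hb, hp, rfl⟩, ε, ε0, hε, hε'⟩ := fX.exists_smul hX.convex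
  obtain ⟨d', d0', ⟨a', ha', b', hb', hp', rfl⟩, δ, δ0, hδ, hδ'⟩ := fY.exists_smul hY.convex
  obtain ⟨h₁, c₁, n₁, X₁, Y₁⟩ := hXY
  have d₁ := eq_of_mem_openSegment X₁ ha hb hp (le_antisymm (X₁ p hpX) (Y₁ p hpY))
  have d₁' : h₁ (b' - a') = 0 := by
    have := eq_of_mem_openSegment (h := -h₁) (c := -c₁) (fun y hy => by simpa using Y₁ y hy)
      ha' hb' hp' (by simp [le_antisymm (X₁ p hpX) (Y₁ p hpY)])
    rwa [LinearMap.neg_apply, neg_eq_zero] at this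
  obtain ⟨t, ht⟩ := exists_vector_eq_smul n₁ d0 d₁ d₁'
  have t0 : t ≠ 0 := by rintro rfl; exact d0' (by simpa using ht)
  set d := b - a
  rw [ht] at hδ hδ'
  have hY' : p + (δ * |t|) • d ∈ Y ∧ p + (δ * |t|) • -d ∈ Y := by
    rcases abs_choice t with e | e <;> rw [e]
    · exact ⟨by rwa [← smul_smul], by rwa [smul_neg, ← smul_smul, ← sub_eq_add_neg]⟩
    · constructor
      · convert hδ' using 1; module
      · convert hδ using 1; module
  have t1 : 0 < δ * |t| := by positivity
  rw [sub_eq_add_neg, ← smul_neg] at hε'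
  have m0 := lt_min ε0 t1
  refine ⟨p + min ε (δ * |t|) • d, ⟨mem_of_le hX.convex hpX m0.le (min_le_left _ _) hε,
    mem_of_le hY.convex hpY m0.le (min_le_right _ _) hY'.1⟩,
    p + min ε (δ * |t|) • -d, ⟨mem_of_le hX.convex hpX m0.le (min_le_left _ _) hε',
    mem_of_le hY.convex hpY m0.le (min_le_right _ _) hY'.2⟩, ?_, ?_⟩
  · intro e
    have e2 : (2 * min ε (δ * |t|)) • d = 0 := by
      have := sub_eq_zero.2 e
      rw [← this]; module
    rcases smul_eq_zero.1 e2 with e3 | e3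
    · linarith
    · exact d0 e3
  · refine ⟨1 / 2, 1 / 2, by norm_num, by norm_num, by norm_num, ?_⟩
    module

/-! ### Contacts in a half plane as touching intervals -/

/-- A family of `#U` nonoverlapping intervals has at most `#U - 1` touching pairs. -/
lemma card_touching_intervals_le {ι : Type*} [DecidableEq ι] {U : Finset ι} {l r : ι → ℝ}
    {K : Finset (ι × ι)} (hlt : ∀ i ∈ U, l i < r i)
    (hdis : ∀ i ∈ U, ∀ j ∈ U, i ≠ j → r i ≤ l j ∨ r j ≤ l i)
    (hK : ∀ e ∈ K, e.1 ∈ U ∧ e.2 ∈ U ∧ (r e.1 = l e.2 ∨ r e.2 = l e.1))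
    (hasymm : ∀ i j, (i, j) ∈ K → (j, i) ∉ K) : K.card ≤ U.card - 1 := by
  rcases U.eq_empty_or_nonempty with rfl | hU
  · have : K = ∅ := Finset.eq_empty_of_forall_notMem fun e he => by simpa using (hK e he).1
    simp [this]
  obtain ⟨m, hm, hmin⟩ := U.exists_min_image l hU
  rw [← Finset.card_erase_of_mem hm]
  have uniq : ∀ i ∈ U, ∀ j ∈ U, r i = r j → i = j := by
    intro i hi j hj hij
    by_contra hne
    rcases hdis i hi j hj hne with h | h
    · linarith [hlt j hj]
    · linarith [hlt i hi]
  -- Each pair is charged to its right-hand member. Right ends are distinct, so this member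
  -- determines its left neighbour; the leftmost interval `m` is never charged.
  refine Finset.card_le_card_of_injOn (fun e => if r e.1 = l e.2 then e.2 else e.1) ?_ ?_
  · intro e he
    obtain ⟨h1, h2, h3⟩ := hK e he
    rw [Finset.mem_coe, Finset.mem_erase]
    dsimp only
    split_ifs with h
    · exact ⟨by rintro rfl; linarith [hmin _ h1, hlt _ h1], h2⟩
    · have h4 := h3.resolve_left h
      exact ⟨by rintro rfl; linarith [hmin _ h2, hlt _ h2], h1⟩
  · rintro ⟨a, b⟩ he ⟨a', b'⟩ he' heq
    obtain ⟨h1, h2, h3⟩ := hK _ he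
    obtain ⟨h1', h2', h3'⟩ := hK _ he'
    dsimp only at *
    split_ifs at heq with h h' h'
    · subst heq
      rw [uniq a h1 a' h1' (h.trans h'.symm)]
    · subst heq
      obtain rfl := uniq a h1 b' h2' (h.trans (h3'.resolve_left h').symm)
      exact absurd he' (hasymm _ _ he)
    · subst heq
      obtain rfl := uniq b h2 a' h1' ((h3.resolve_left h).trans h'.symm)
      exact absurd he' (hasymm _ _ he)
    · subst heq
      rw [uniq b h2 b' h2' ((h3.resolve_left h).trans (h3'.resolve_left h').symm)]

lemma exists_mem_level {X : Set Plane} (hX : Convex ℝ X) {f : Plane →ₗ[ℝ] ℝ} {p x : Plane} {c : ℝ}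
    (hp : p ∈ X) (hx : x ∈ X) (hpc : f p < c) (hcx : c ≤ f x) :
    ∃ t : ℝ, 0 < t ∧ t ≤ 1 ∧ p + t • (x - p) ∈ X ∧ f (p + t • (x - p)) = c := by
  have h : 0 < f x - f p := by linarith
  refine ⟨(c - f p) / (f x - f p), div_pos (by linarith) h, (div_le_one h).2 (by linarith), ?_, ?_⟩
  · exact hX.add_smul_sub_mem hp hx ⟨(div_pos (by linarith) h).le, (div_le_one h).2 (by linarith)⟩
  · simp only [map_add, map_smul, map_sub, smul_eq_mul]
    field_simp
    ring

/-- The segment from `p` to `x` crosses the level once. A point `y` off their line gives a second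
crossing, on the segment to `y` from `p` or from `x`; `h`, constant along the first segment, tells
the two apart. -/
lemma exists_two_mem_level {X : Set Plane} (hX : IsBody X) {f : Plane →ₗ[ℝ] ℝ} {p x : Plane}
    {c : ℝ} (hp : p ∈ X) (hx : x ∈ X) (hpc : f p < c) (hcx : c < f x) :
    ∃ z ∈ X, ∃ w ∈ X, z ≠ w ∧ f z = c ∧ f w = c := by
  have hne : x - p ≠ 0 := by
    rw [sub_ne_zero]
    rintro rfl
    linarith
  obtain ⟨h, h0, hv⟩ := exists_functional_vanishing hne
  obtain ⟨y, hy, hyp⟩ := hX.solid h h0 (h p)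
  have hv' : h x = h p := by rwa [map_sub, sub_eq_zero] at hv
  obtain ⟨t, -, -, ht, htc⟩ := exists_mem_level hX.convex hp hx hpc hcx.le
  refine ⟨_, ht, ?_⟩
  rcases le_or_gt c (f y) with hcy | hcy
  · obtain ⟨s, s0, -, hs, hsc⟩ := exists_mem_level hX.convex hp hy hpc hcy
    refine ⟨_, hs, fun e => ?_, htc, hsc⟩
    have := congrArg h e
    simp only [map_add, map_smul, hv, smul_eq_mul, map_sub] at this
    have h2 : s * (h y - h p) = 0 := by linarith [hv']
    rcases mul_eq_zero.1 h2 with h3 | h3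
    · exact s0.ne' h3
    · exact hyp (by linarith)
  · obtain ⟨s, s0, -, hs, hsc⟩ := exists_mem_level (f := -f) (c := -c) hX.convex hx hy
      (by simpa using hcx) (by simpa using hcy.le)
    refine ⟨_, hs, fun e => ?_, htc, neg_injective (by simpa only [LinearMap.neg_apply] using hsc)⟩
    have := congrArg h e
    simp only [map_add, map_smul, hv, smul_eq_mul, map_sub] at this
    have h2 : s * (h y - h p) = 0 := by rw [← hv']; linarith [hv']
    rcases mul_eq_zero.1 h2 with h3 | h3
    · exact s0.ne' h3
    · exact hyp (by linarith)

/-- A level line of `f` cuts a body in an interval, measured by a complementary functional. -/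
lemma exists_slice {X : Set Plane} (hX : IsBody X) {f g : Plane →ₗ[ℝ] ℝ}
    (hfg : ∀ z, f z = 0 → g z = 0 → z = 0) {p x : Plane} {c : ℝ}
    (hp : p ∈ X) (hx : x ∈ X) (hpc : f p < c) (hcx : c < f x) :
    ∃ l r : ℝ, l < r ∧ (∀ s, l ≤ s → s ≤ r → ∃ z ∈ X, f z = c ∧ g z = s) ∧
      ∀ z ∈ X, f z = c → l ≤ g z ∧ g z ≤ r := by
  obtain ⟨z, hz, w, hw, hzw, hzc, hwc⟩ := exists_two_mem_level hX hp hx hpc hcx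
  have hcomp : IsCompact (X ∩ {z | f z = c}) :=
    hX.compact.inter_right
      (isClosed_eq f.continuous_of_finiteDimensional continuous_const)
  have hgc := g.continuous_of_finiteDimensional
  obtain ⟨a, ⟨ha, hac⟩, hmin⟩ := hcomp.exists_isMinOn ⟨z, hz, hzc⟩ hgc.continuousOn
  obtain ⟨b, ⟨hb, hbc⟩, hmax⟩ := hcomp.exists_isMaxOn ⟨z, hz, hzc⟩ hgc.continuousOn
  have hbd : ∀ z ∈ X, f z = c → g a ≤ g z ∧ g z ≤ g b :=
    fun z hz hzc => ⟨hmin ⟨hz, hzc⟩, hmax ⟨hz, hzc⟩⟩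
  refine ⟨g a, g b, ?_, ?_, hbd⟩
  · by_contra! hle
    have h1 := hbd z hz hzc
    have h2 := hbd w hw hwc
    exact hzw (sub_eq_zero.1 (hfg _ (by rw [map_sub]; linarith) (by rw [map_sub]; linarith)))
  · intro s h1 h2
    rcases h1.eq_or_lt with rfl | h1
    · exact ⟨a, ha, hac, rfl⟩
    obtain ⟨t, -, -, ht, hts⟩ := exists_mem_level hX.convex ha hb h1 h2
    refine ⟨_, ht, ?_, hts⟩
    have e1 : f a = c := hac
    have e2 : f b = c := hbc
    simp [e1, e2]

/-- Two common points at one level force the separating line to be that level line, but `X` has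
points strictly on both sides of it. -/
lemma not_separated_of_level {X Y : Set Plane} (hXY : Separated X Y) {f : Plane →ₗ[ℝ] ℝ}
    {z w p x : Plane} (hzw : z ≠ w) (hzX : z ∈ X) (hwX : w ∈ X) (hzY : z ∈ Y) (hwY : w ∈ Y)
    (hf : f z = f w) (hp : p ∈ X) (hx : x ∈ X) (hpz : f p < f z) (hzx : f z < f x) : False := by
  obtain ⟨h, c, h0, hX, hY⟩ := hXY
  have e1 : h z = c := le_antisymm (hX z hzX) (hY z hzY)
  have e2 : h w = c := le_antisymm (hX w hwX) (hY w hwY)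
  have hf0 : f ≠ 0 := by rintro rfl; simp at hpz
  obtain ⟨α, rfl⟩ := exists_eq_smul (sub_ne_zero.2 hzw) hf0 (by simp [hf])
    (show h (z - w) = 0 by simp [e1, e2])
  have h1 := hX p hp
  have h2 := hX x hx
  simp only [LinearMap.smul_apply, smul_eq_mul] at h1 h2 e1
  subst e1
  have : α = 0 := le_antisymm (by by_contra! h; nlinarith) (by by_contra! h; nlinarith)
  simp [this] at h0

section Family

variable {ι : Type*} {X : ι → Set Plane}

/-- Bodies with disjoint interiors that reach from `p` into an open half plane bounded by a line
through `p` have fewer contacts there than their number. -/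
lemma card_contacts_le (hB : ∀ i, IsBody (X i))
    (hS : ∀ i j, i ≠ j → Separated (X i) (X j)) {p : Plane} {f : Plane →ₗ[ℝ] ℝ} {U : Finset ι}
    {K : Finset (ι × ι)} (hU : ∀ i ∈ U, p ∈ X i ∧ ∃ x ∈ X i, f p < f x)
    (hK : ∀ e ∈ K, e.1 ∈ U ∧ e.2 ∈ U ∧ ∃ q ∈ X e.1 ∩ X e.2, f p < f q)
    (hasymm : ∀ i j, (i, j) ∈ K → (j, i) ∉ K) : K.card ≤ U.card - 1 := by
  classical
  rcases U.eq_empty_or_nonempty with rfl | ⟨i₀, hi₀⟩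
  · have : K = ∅ := Finset.eq_empty_of_forall_notMem fun e he => by simpa using (hK e he).1
    simp [this]
  have hf0 : f ≠ 0 := by
    rintro rfl
    obtain ⟨-, x, -, hx⟩ := hU i₀ hi₀
    simp at hx
  obtain ⟨g, hfg⟩ := exists_complementary hf0
  have hU' : ∀ i, ∃ x, i ∈ U → x ∈ X i ∧ f p < f x := fun i => by
    by_cases hi : i ∈ U
    · obtain ⟨x, hx⟩ := (hU i hi).2
      exact ⟨x, fun _ => hx⟩
    · exact ⟨0, fun h => absurd h hi⟩
  have hK' : ∀ e, ∃ x, e ∈ K → x ∈ X e.1 ∩ X e.2 ∧ f p < f x := fun e => by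
    by_cases he : e ∈ K
    · obtain ⟨x, hx⟩ := (hK e he).2.2
      exact ⟨x, fun _ => hx⟩
    · exact ⟨0, fun h => absurd h he⟩
  choose x hx using hU'
  choose q hq using hK'
  -- The level is chosen so close to `f p` that every body of `U` and every contact of `K` crosses
  -- it.
  obtain ⟨c, ⟨hcU, hcK⟩, hpc⟩ : ∃ c, ((∀ i ∈ U, c < f (x i)) ∧ ∀ e ∈ K, c < f (q e)) ∧ f p < c := by
    have h1 : ∀ᶠ c in nhdsWithin (f p) (Set.Ioi (f p)), ∀ i ∈ U, c < f (x i) :=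
      (Filter.eventually_all_finset U).2 fun i hi =>
        (eventually_lt_nhds (hx i hi).2).filter_mono nhdsWithin_le_nhds
    have h2 : ∀ᶠ c in nhdsWithin (f p) (Set.Ioi (f p)), ∀ e ∈ K, c < f (q e) :=
      (Filter.eventually_all_finset K).2 fun e he =>
        (eventually_lt_nhds (hq e he).2).filter_mono nhdsWithin_le_nhds
    exact ((h1.and h2).and self_mem_nhdsWithin).exists
  have hsl : ∀ i, ∃ l r : ℝ, i ∈ U → l < r ∧
      (∀ s, l ≤ s → s ≤ r → ∃ z ∈ X i, f z = c ∧ g z = s) ∧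
      ∀ z ∈ X i, f z = c → l ≤ g z ∧ g z ≤ r := fun i => by
    by_cases hi : i ∈ U
    · obtain ⟨l, r, h⟩ := exists_slice (hB i) hfg (hU i hi).1 (hx i hi).1 hpc (hcU i hi)
      exact ⟨l, r, fun _ => h⟩
    · exact ⟨0, 0, fun h => absurd h hi⟩
  choose l r hlr using hsl
  have hdis : ∀ i ∈ U, ∀ j ∈ U, i ≠ j → r i ≤ l j ∨ r j ≤ l i := by
    intro i hi j hj hij
    by_contra! hcon
    obtain ⟨hi1, hi2, hi3⟩ := hlr i hi
    obtain ⟨hj1, hj2, hj3⟩ := hlr j hj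
    -- Overlapping slices would give two common points of the bodies on the level line.
    obtain ⟨s, t, hs, hst, ht⟩ : ∃ s t, max (l i) (l j) ≤ s ∧ s < t ∧ t ≤ min (r i) (r j) :=
      ⟨_, _, le_rfl, max_lt (lt_min hi1 hcon.2) (lt_min hcon.1 hj1), le_rfl⟩
    rw [max_le_iff] at hs
    rw [le_min_iff] at ht
    have same : ∀ z w, f z = c → f w = c → g z = g w → z = w := fun z w h1 h2 h3 =>
      sub_eq_zero.1 (hfg _ (by rw [map_sub, h1, h2, sub_self]) (by rw [map_sub, h3, sub_self]))
    obtain ⟨z, hz, hzc, hzs⟩ := hi2 s hs.1 (hst.le.trans ht.1)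
    obtain ⟨z', hz', hzc', hzs'⟩ := hj2 s hs.2 (hst.le.trans ht.2)
    obtain rfl := same z z' hzc hzc' (hzs.trans hzs'.symm)
    obtain ⟨w, hw, hwc, hwt⟩ := hi2 t (hs.1.trans hst.le) ht.1
    obtain ⟨w', hw', hwc', hwt'⟩ := hj2 t (hs.2.trans hst.le) ht.2
    obtain rfl := same w w' hwc hwc' (hwt.trans hwt'.symm)
    exact not_separated_of_level (hS i j hij) (by rintro rfl; linarith) hz hw hz' hw'
      (hzc.trans hwc.symm) (hU i hi).1 (hx i hi).1 (hzc ▸ hpc) (hzc ▸ hcU i hi)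
  refine card_touching_intervals_le (l := l) (r := r) (fun i hi => (hlr i hi).1) hdis ?_ hasymm
  intro e he
  obtain ⟨h1, h2, -⟩ := hK e he
  obtain ⟨⟨hq1, hq2⟩, hq3⟩ := hq e he
  obtain ⟨t, -, -, ht, htc⟩ := exists_mem_level ((hB e.1).convex.inter (hB e.2).convex)
    ⟨(hU _ h1).1, (hU _ h2).1⟩ ⟨hq1, hq2⟩ hpc (hcK e he).le
  have b1 := (hlr _ h1).2.2 _ ht.1 htc
  have b2 := (hlr _ h2).2.2 _ ht.2 htc
  refine ⟨h1, h2, ?_⟩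
  have hne : e.1 ≠ e.2 := by
    intro e12
    have he' : (e.1, e.2) ∈ K := he
    rw [← e12] at he'
    exact hasymm _ _ he' he'
  exact (hdis _ h1 _ h2 hne).imp (fun h => by linarith) (fun h => by linarith)

end Family

lemma isFlat_of_notMem_vertices {T : Affine.Triangle ℝ Plane} {p : Plane} (hp : p ∈ region T)
    (hv : p ∉ Set.range T.points) : IsFlat (region T) p := by
  have h : p ∉ (region T).extremePoints ℝ := fun h => hv (extremePoints_convexHull_subset h)
  rw [mem_extremePoints_iff_left] at h
  push Not at h
  obtain ⟨a, ha, b, hb, hpab, hne⟩ := h hp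
  refine ⟨a, ha, b, hb, ?_, hpab⟩
  rintro rfl
  rw [openSegment_same] at hpab
  exact hne hpab.symm

/-! ### Contact systems and the count of ends -/

/-- A finite family of triangles, a set `K` of pairs of them in nontrivial contact, and a
functional `f` together with the ends `lo e` and `hi e` of each contact, ordered by `f`. -/
structure ContactSystem (ι : Type*) where
  T : ι → Affine.Triangle ℝ Plane
  W : Finset ι
  K : Finset (ι × ι)
  f : Plane →ₗ[ℝ] ℝ
  lo : ι × ι → Plane
  hi : ι × ι → Plane
  separated : ∀ i j, i ≠ j → Separated (region (T i)) (region (T j))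
  mem_W : ∀ e ∈ K, e.1 ∈ W ∧ e.2 ∈ W
  asymm : ∀ i j, (i, j) ∈ K → (j, i) ∉ K
  lo_mem : ∀ e ∈ K, lo e ∈ region (T e.1) ∩ region (T e.2)
  hi_mem : ∀ e ∈ K, hi e ∈ region (T e.1) ∩ region (T e.2)
  lo_lt_hi : ∀ e ∈ K, f (lo e) < f (hi e)
  lo_le : ∀ e ∈ K, ∀ z ∈ region (T e.1) ∩ region (T e.2), f (lo e) ≤ f z
  le_hi : ∀ e ∈ K, ∀ z ∈ region (T e.1) ∩ region (T e.2), f z ≤ f (hi e)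

lemma exists_contactSystem {ι : Type*} (T : ι → Affine.Triangle ℝ Plane) (W : Finset ι)
    (K : Finset (ι × ι))
    (hS : ∀ i j, i ≠ j → Separated (region (T i)) (region (T j)))
    (hW : ∀ e ∈ K, e.1 ∈ W ∧ e.2 ∈ W) (hasymm : ∀ i j, (i, j) ∈ K → (j, i) ∉ K)
    (hK : ∀ e ∈ K, ∃ a b, a ≠ b ∧ a ∈ region (T e.1) ∩ region (T e.2) ∧
      b ∈ region (T e.1) ∩ region (T e.2)) :
    ∃ S : ContactSystem ι, S.T = T ∧ S.W = W ∧ S.K = K := by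
  choose! a b hab ha hb using hK
  obtain ⟨f, hf⟩ := Module.exists_dual_forall_apply_ne_zero (K := ℝ)
    (fun e : K => a e.1 - b e.1) (fun e => sub_ne_zero.2 (hab e.1 e.2))
  have hfc : Continuous f := f.continuous_of_finiteDimensional
  have hcomp : ∀ e : ι × ι, IsCompact (region (T e.1) ∩ region (T e.2)) := fun e =>
    (isCompact_region _).inter (isCompact_region _)
  have hmin : ∀ e ∈ K, ∃ x ∈ region (T e.1) ∩ region (T e.2),
      ∀ z ∈ region (T e.1) ∩ region (T e.2), f x ≤ f z := fun e he => by
    obtain ⟨x, hx, h⟩ := (hcomp e).exists_isMinOn ⟨_, ha e he⟩ hfc.continuousOn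
    exact ⟨x, hx, fun z hz => h hz⟩
  have hmax : ∀ e ∈ K, ∃ x ∈ region (T e.1) ∩ region (T e.2),
      ∀ z ∈ region (T e.1) ∩ region (T e.2), f z ≤ f x := fun e he => by
    obtain ⟨x, hx, h⟩ := (hcomp e).exists_isMaxOn ⟨_, ha e he⟩ hfc.continuousOn
    exact ⟨x, hx, fun z hz => h hz⟩
  choose! lo hlo hlo' using hmin
  choose! hi hhi hhi' using hmax
  refine ⟨⟨T, W, K, f, lo, hi, hS, hW, hasymm, hlo, hhi, fun e he => ?_, hlo', hhi'⟩, rfl, rfl, rfl⟩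
  by_contra! hle
  apply hf ⟨e, he⟩
  rw [map_sub]
  linarith [hlo' e he _ (ha e he), hlo' e he _ (hb e he), hhi' e he _ (ha e he),
    hhi' e he _ (hb e he)]

namespace ContactSystem

open Classical in
/-- The contacts that end at `p`. -/
noncomputable def ends {ι : Type*} (S : ContactSystem ι) (p : Plane) : Finset (ι × ι) :=
  S.K.filter fun e => S.lo e = p ∨ S.hi e = p

open Classical in
/-- The triangles with a vertex at `p`. -/
noncomputable def vert {ι : Type*} (S : ContactSystem ι) (p : Plane) : Finset ι :=
  S.W.filter fun i => p ∈ Set.range (S.T i).points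

open Classical in
/-- The triangles with their middle vertex, in the order of `f`, at `p`. -/
noncomputable def mid {ι : Type*} (S : ContactSystem ι) (p : Plane) : Finset ι :=
  (S.vert p).filter fun i =>
    (∃ x ∈ region (S.T i), S.f p < S.f x) ∧ ∃ x ∈ region (S.T i), S.f x < S.f p

open Classical in
/-- The triangles that contain `p`, but not as a vertex. -/
noncomputable def flat {ι : Type*} (S : ContactSystem ι) (p : Plane) : Finset ι :=
  S.W.filter fun i => p ∈ region (S.T i) ∧ p ∉ Set.range (S.T i).points

open Classical in
/-- The vertices of the triangles and the ends of the contacts. -/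
noncomputable def nodes {ι : Type*} (S : ContactSystem ι) : Finset Plane :=
  (S.W.biUnion fun i => Finset.univ.image (S.T i).points) ∪ S.K.image S.lo ∪ S.K.image S.hi

/-- `p` is the unique point of the union of the triangles at which some functional is maximal. -/
def Exposed {ι : Type*} (S : ContactSystem ι) (p : Plane) : Prop :=
  ∃ g : Plane →ₗ[ℝ] ℝ, ∀ i ∈ S.W, ∀ x ∈ region (S.T i), x ≠ p → g x < g p

variable {ι : Type*} (S : ContactSystem ι)

lemma ne_of_mem {e : ι × ι} (he : e ∈ S.K) : e.1 ≠ e.2 := by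
  intro h
  have he' : (e.1, e.2) ∈ S.K := he
  rw [← h] at he'
  exact S.asymm _ _ he' he'

lemma mem_ends {p : Plane} {e : ι × ι} :
    e ∈ S.ends p ↔ e ∈ S.K ∧ (S.lo e = p ∨ S.hi e = p) := by
  simp [ends]

lemma mem_vert {p : Plane} {i : ι} :
    i ∈ S.vert p ↔ i ∈ S.W ∧ p ∈ Set.range (S.T i).points := by
  simp [vert]

lemma mem_flat {p : Plane} {i : ι} :
    i ∈ S.flat p ↔ i ∈ S.W ∧ p ∈ region (S.T i) ∧ p ∉ Set.range (S.T i).points := by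
  simp [flat]

lemma mem_inter_of_mem_ends {p : Plane} {e : ι × ι} (he : e ∈ S.ends p) :
    p ∈ region (S.T e.1) ∩ region (S.T e.2) := by
  obtain ⟨h, rfl | rfl⟩ := S.mem_ends.1 he
  · exact S.lo_mem e h
  · exact S.hi_mem e h

lemma exists_ne_of_mem_ends {p : Plane} {e : ι × ι} (he : e ∈ S.ends p) :
    ∃ q ∈ region (S.T e.1) ∩ region (S.T e.2), q ≠ p := by
  obtain ⟨h, rfl | rfl⟩ := S.mem_ends.1 he
  · exact ⟨_, S.hi_mem e h, fun h' => (S.lo_lt_hi e h).ne (congrArg S.f h').symm⟩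
  · exact ⟨_, S.lo_mem e h, fun h' => (S.lo_lt_hi e h).ne (congrArg S.f h')⟩

lemma apply_ne_of_mem_inter {e : ι × ι} (he : e ∈ S.K) {a b : Plane} (hab : a ≠ b)
    (ha : a ∈ region (S.T e.1) ∩ region (S.T e.2))
    (hb : b ∈ region (S.T e.1) ∩ region (S.T e.2)) : S.f a ≠ S.f b := by
  intro hf
  obtain ⟨h, c, h0, h1, h2⟩ := S.separated _ _ (S.ne_of_mem he)
  have hc : ∀ z ∈ region (S.T e.1) ∩ region (S.T e.2), h z = c := fun z hz =>
    le_antisymm (h1 z hz.1) (h2 z hz.2)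
  have hlt := S.lo_lt_hi e he
  have hf0 : S.f ≠ 0 := by
    intro h0
    simp [h0] at hlt
  obtain ⟨α, rfl⟩ := exists_eq_smul (sub_ne_zero.2 hab) hf0 (by simp [hf])
    (show h (a - b) = 0 by simp [hc a ha, hc b hb])
  have e1 := hc _ (S.lo_mem e he)
  rw [← hc _ (S.hi_mem e he)] at e1
  simp only [LinearMap.smul_apply, smul_eq_mul] at e1
  have hα : α ≠ 0 := by
    rintro rfl
    simp at h0
  exact hlt.ne (mul_left_cancel₀ hα e1)

/-- `f` is injective on a contact and extremal at its ends, so an end is not inside a segment of the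
contact. -/
lemma not_isFlat_of_mem_ends {p : Plane} {e : ι × ι} (he : e ∈ S.ends p) :
    ¬ IsFlat (region (S.T e.1) ∩ region (S.T e.2)) p := by
  rintro ⟨a, ha, b, hb, hab, s, t, hs, ht, hst, hp⟩
  have hK := (S.mem_ends.1 he).1
  apply S.apply_ne_of_mem_inter hK hab ha hb
  have hfp := congrArg S.f hp
  simp only [map_add, map_smul, smul_eq_mul] at hfp
  obtain rfl : s = 1 - t := by linarith
  rcases (S.mem_ends.1 he).2 with rfl | rfl
  · have h1 := S.lo_le e hK a ha
    have h2 := S.lo_le e hK b hb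
    apply le_antisymm <;> nlinarith
  · have h1 := S.le_hi e hK a ha
    have h2 := S.le_hi e hK b hb
    apply le_antisymm <;> nlinarith

/-- Two flat triangles at `p` leave room for no third, so a contact ending at `p` would be theirs.
Their intersection is however flat at `p`, so `p` is not an end. -/
lemma card_flat_le_one {p : Plane} {e : ι × ι} (he : e ∈ S.ends p) : (S.flat p).card ≤ 1 := by
  rw [Finset.card_le_one]
  intro i hi j hj
  by_contra hij
  have hp := S.mem_inter_of_mem_ends he
  obtain ⟨-, hi1, hi2⟩ := S.mem_flat.1 hi
  obtain ⟨-, hj1, hj2⟩ := S.mem_flat.1 hj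
  have fi := isFlat_of_notMem_vertices hi1 hi2
  have fj := isFlat_of_notMem_vertices hj1 hj2
  have third : ∀ k, p ∈ region (S.T k) → k = i ∨ k = j := by
    intro k hk
    by_contra! hne
    exact not_three_flat (isBody_region _) (isBody_region _) (isBody_region _)
      (S.separated i j hij) (S.separated i k hne.1.symm) (S.separated j k hne.2.symm) fi fj hk
  have hflat := S.not_isFlat_of_mem_ends he
  have hne := S.ne_of_mem (S.mem_ends.1 he).1
  have f1 : IsFlat (region (S.T e.1)) p := by
    rcases third _ hp.1 with h | h <;> rwa [h]
  have f2 : IsFlat (region (S.T e.2)) p := by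
    rcases third _ hp.2 with h | h <;> rwa [h]
  exact hflat (isFlat_inter (isBody_region _) (isBody_region _) (S.separated _ _ hne) f1 f2)

lemma card_ends_le_add_mid (p : Plane) :
    (S.ends p).card ≤ (S.vert p).card + (S.mid p).card := by
  classical
  rcases (S.ends p).eq_empty_or_nonempty with h0 | ⟨e₀, he₀⟩
  · simp [h0]
  have hflat := S.card_flat_le_one he₀
  set U := S.W.filter fun i => p ∈ region (S.T i) ∧ ∃ x ∈ region (S.T i), S.f p < S.f x with hU
  set D := S.W.filter fun i => p ∈ region (S.T i) ∧ ∃ x ∈ region (S.T i), S.f x < S.f p with hD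
  set B := (S.vert p).filter fun i => ∃ x ∈ region (S.T i), S.f p < S.f x with hB
  set C := (S.vert p).filter fun i => ∃ x ∈ region (S.T i), S.f x < S.f p with hC
  have hbody : ∀ i, IsBody (region (S.T i)) := fun i => isBody_region _
  have h1 : (S.K.filter fun e => S.lo e = p).card ≤ U.card - 1 := by
    refine card_contacts_le (X := fun i => region (S.T i)) hbody S.separated (p := p) (f := S.f)
      (fun i hi => (Finset.mem_filter.1 hi).2) ?_ ?_
    · intro e he
      obtain ⟨he', rfl⟩ := Finset.mem_filter.1 he
      have a1 := S.lo_mem e he'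
      have a2 := S.hi_mem e he'
      have a3 := S.lo_lt_hi e he'
      exact ⟨Finset.mem_filter.2 ⟨(S.mem_W e he').1, a1.1, _, a2.1, a3⟩,
        Finset.mem_filter.2 ⟨(S.mem_W e he').2, a1.2, _, a2.2, a3⟩, _, a2, a3⟩
    · exact fun i j h h' => S.asymm i j (Finset.mem_filter.1 h).1 (Finset.mem_filter.1 h').1
  have h2 : (S.K.filter fun e => S.hi e = p).card ≤ D.card - 1 := by
    refine card_contacts_le (X := fun i => region (S.T i)) hbody S.separated (p := p) (f := -S.f)
      (fun i hi => by simpa using (Finset.mem_filter.1 hi).2) ?_ ?_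
    · intro e he
      obtain ⟨he', rfl⟩ := Finset.mem_filter.1 he
      have a1 := S.hi_mem e he'
      have a2 := S.lo_mem e he'
      have a3 := S.lo_lt_hi e he'
      exact ⟨Finset.mem_filter.2 ⟨(S.mem_W e he').1, a1.1, _, a2.1, a3⟩,
        Finset.mem_filter.2 ⟨(S.mem_W e he').2, a1.2, _, a2.2, a3⟩, _, a2, by simpa using a3⟩
    · exact fun i j h h' => S.asymm i j (Finset.mem_filter.1 h).1 (Finset.mem_filter.1 h').1
  have h3 : (S.ends p).card ≤ (S.K.filter fun e => S.lo e = p).card +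
      (S.K.filter fun e => S.hi e = p).card := by
    rw [ends, Finset.filter_or]
    convert Finset.card_union_le _ _
  have h4 : U.card ≤ B.card + (S.flat p).card := by
    refine (Finset.card_le_card fun i hi => ?_).trans (Finset.card_union_le _ _)
    obtain ⟨hi, hp, hx⟩ := Finset.mem_filter.1 hi
    rw [Finset.mem_union, hB, Finset.mem_filter, mem_vert, mem_flat]
    by_cases hv : p ∈ Set.range (S.T i).points
    · exact Or.inl ⟨⟨hi, hv⟩, hx⟩
    · exact Or.inr ⟨hi, hp, hv⟩
  have h5 : D.card ≤ C.card + (S.flat p).card := by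
    refine (Finset.card_le_card fun i hi => ?_).trans (Finset.card_union_le _ _)
    obtain ⟨hi, hp, hx⟩ := Finset.mem_filter.1 hi
    rw [Finset.mem_union, hC, Finset.mem_filter, mem_vert, mem_flat]
    by_cases hv : p ∈ Set.range (S.T i).points
    · exact Or.inl ⟨⟨hi, hv⟩, hx⟩
    · exact Or.inr ⟨hi, hp, hv⟩
  have h6 : B.card + C.card ≤ (S.vert p).card + (S.mid p).card := by
    -- `B ∪ C` lies in `S.vert p`, and `B ∩ C` is `S.mid p`.
    rw [← Finset.card_union_add_card_inter, ← Finset.filter_or, ← Finset.filter_and]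
    have : (S.mid p) = (S.vert p).filter fun i => (∃ x ∈ region (S.T i), S.f p < S.f x) ∧
      ∃ x ∈ region (S.T i), S.f x < S.f p := by
        rw [mid]
    rw [this]
    gcongr
    exact Finset.filter_subset _ _
  have h7 : B.card ≤ (S.vert p).card := Finset.card_filter_le _ _
  have h8 : C.card ≤ (S.vert p).card := Finset.card_filter_le _ _
  omega

lemma Exposed.mem_vert {S : ContactSystem ι} {p : Plane} (hp : S.Exposed p) {i : ι} (hi : i ∈ S.W)
    (hpi : p ∈ region (S.T i)) : i ∈ S.vert p := by
  rw [S.mem_vert]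
  refine ⟨hi, ?_⟩
  by_contra hv
  obtain ⟨g, hg⟩ := hp
  obtain ⟨a, ha, b, hb, hab, hpab⟩ := isFlat_of_notMem_vertices hpi hv
  have hle : ∀ x ∈ region (S.T i), g x ≤ g p := fun x hx => by
    rcases eq_or_ne x p with rfl | h
    · exact le_rfl
    · exact (hg i hi x hx h).le
  have h0 := eq_of_mem_openSegment hle ha hb hpab rfl
  rw [map_sub] at h0
  obtain ⟨s, t, hs, ht, hst, rfl⟩ := hpab
  have e1 : g (s • a + t • b) = g a := by
    obtain rfl : s = 1 - t := by linarith
    simp only [map_add, map_smul, smul_eq_mul]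
    linear_combination t * h0
  have ha' : a = s • a + t • b := by
    by_contra h
    exact (hg i hi a ha h).ne e1.symm
  have hb' : b = s • a + t • b := by
    by_contra h
    exact (hg i hi b hb h).ne (by linarith)
  exact hab (ha'.trans hb'.symm)

/-- All triangles through `p` have a vertex there and reach into the single half plane `g < g p`, so
one application of `card_contacts_le` counts all ends at once. -/
lemma Exposed.card_ends_lt {S : ContactSystem ι} {p : Plane} (hp : S.Exposed p)
    (hv : (S.vert p).Nonempty) : (S.ends p).card + 1 ≤ (S.vert p).card := by
  classical
  suffices h : (S.ends p).card ≤ (S.vert p).card - 1 by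
    have := hv.card_pos
    omega
  have hp' := hp
  obtain ⟨g, hg⟩ := hp
  refine card_contacts_le (X := fun i => region (S.T i)) (fun i => isBody_region _) S.separated
    (p := p) (f := -g) ?_ ?_ ?_
  · intro i hi
    obtain ⟨hi, hpi⟩ := S.mem_vert.1 hi
    -- Any nonzero functional would do: only a point of the triangle other than `p` is needed.
    obtain ⟨z, hz, hzp⟩ := (isBody_region (S.T i)).solid (functional 1 0) (by simp [functional_ne_zero_iff]) (functional 1 0 p)
    refine ⟨subset_convexHull ℝ _ hpi, z, hz, ?_⟩
    simpa using hg i hi z hz (by rintro rfl; exact hzp rfl)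
  · intro e he
    obtain ⟨q, hq, hqp⟩ := S.exists_ne_of_mem_ends he
    have hpe := S.mem_inter_of_mem_ends he
    have hW := S.mem_W e (S.mem_ends.1 he).1
    exact ⟨hp'.mem_vert hW.1 hpe.1, hp'.mem_vert hW.2 hpe.2, q, hq,
      by simpa using hg _ hW.1 q hq.1 hqp⟩
  · exact fun i j h h' => S.asymm i j (S.mem_ends.1 h).1 (S.mem_ends.1 h').1

lemma sum_card_ends : ∑ p ∈ S.nodes, (S.ends p).card = 2 * S.K.card := by
  classical
  have h1 : ∀ p, (S.ends p).card = (S.K.filter fun e => S.lo e = p).card +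
      (S.K.filter fun e => S.hi e = p).card := by
    intro p
    rw [ends, Finset.filter_or]
    convert Finset.card_union_of_disjoint ?_
    rw [Finset.disjoint_filter]
    rintro e he rfl h
    exact (S.lo_lt_hi e he).ne (congrArg S.f h).symm
  simp_rw [h1, Finset.sum_add_distrib]
  rw [← Finset.card_eq_sum_card_fiberwise, ← Finset.card_eq_sum_card_fiberwise, two_mul]
  · intro e he
    simp only [nodes, Finset.coe_union, Set.mem_union, Finset.mem_coe]
    exact Or.inr (Finset.mem_image_of_mem _ he)
  · intro e he
    simp only [nodes, Finset.coe_union, Set.mem_union, Finset.mem_coe]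
    exact Or.inl (Or.inr (Finset.mem_image_of_mem _ he))

lemma mem_nodes_of_vertex {i : ι} (hi : i ∈ S.W) {p : Plane} (hp : p ∈ Set.range (S.T i).points) :
    p ∈ S.nodes := by
  classical
  obtain ⟨a, rfl⟩ := hp
  simp only [nodes, Finset.mem_union, Finset.mem_biUnion]
  exact Or.inl (Or.inl ⟨i, hi, Finset.mem_image_of_mem _ (Finset.mem_univ a)⟩)

lemma sum_card_vert : ∑ p ∈ S.nodes, (S.vert p).card = 3 * S.W.card := by
  classical
  have h := Finset.sum_card_bipartiteAbove_eq_sum_card_bipartiteBelow (s := S.nodes) (t := S.W)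
    (fun p i => p ∈ Set.range (S.T i).points)
  have h1 : ∀ p, S.vert p = S.W.bipartiteAbove (fun p i => p ∈ Set.range (S.T i).points) p := by
    intro p
    ext i
    simp [mem_vert, Finset.mem_bipartiteAbove]
  simp_rw [h1]
  rw [h, Finset.sum_congr rfl (g := fun _ => 3), Finset.sum_const, smul_eq_mul, mul_comm]
  intro i hi
  have : S.nodes.bipartiteBelow (fun p i => p ∈ Set.range (S.T i).points) i =
      Finset.univ.image (S.T i).points := by
    ext p
    simp only [Finset.mem_bipartiteBelow, Finset.mem_image, Finset.mem_univ, true_and,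
      Set.mem_range]
    exact ⟨fun h => h.2, fun h => ⟨S.mem_nodes_of_vertex hi h, h⟩⟩
  rw [this, Finset.card_image_of_injective _ (S.T i).independent.injective]
  simp

lemma exists_vertex_lt {T : Affine.Triangle ℝ Plane} {f : Plane →ₗ[ℝ] ℝ} {c : ℝ}
    (h : ∃ x ∈ region T, c < f x) : ∃ a, c < f (T.points a) := by
  by_contra! hle
  obtain ⟨x, hx, hc⟩ := h
  have : region T ⊆ {z | f z ≤ c} := convexHull_min (by rintro _ ⟨a, rfl⟩; exact hle a)
    (convex_halfSpace_le f.isLinear c)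
  exact absurd (this hx) (not_le.2 hc)

lemma sum_card_mid_le : ∑ p ∈ S.nodes, (S.mid p).card ≤ S.W.card := by
  classical
  have h := Finset.sum_card_bipartiteAbove_eq_sum_card_bipartiteBelow (s := S.nodes) (t := S.W)
    (fun p i => i ∈ S.mid p)
  have h1 : ∀ p, S.mid p = S.W.bipartiteAbove (fun p i => i ∈ S.mid p) p := by
    intro p
    ext i
    simp only [Finset.mem_bipartiteAbove]
    exact ⟨fun h => ⟨(S.mem_vert.1 (Finset.mem_filter.1 h).1).1, h⟩, fun h => h.2⟩
  rw [Finset.sum_congr rfl (fun p _ => congrArg Finset.card (h1 p)), h, Finset.card_eq_sum_ones]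
  refine Finset.sum_le_sum fun i hi => Finset.card_le_one.2 fun p hp q hq => ?_
  have key : ∀ p, i ∈ S.mid p → ∃ a, (S.T i).points a = p ∧
      (∃ b, S.f p < S.f ((S.T i).points b)) ∧ ∃ b, S.f ((S.T i).points b) < S.f p := by
    intro p hp
    obtain ⟨hv, hx, y, hy, hyp⟩ := Finset.mem_filter.1 hp
    obtain ⟨a, ha⟩ := (S.mem_vert.1 hv).2
    obtain ⟨b, hb⟩ := exists_vertex_lt (f := -S.f) (c := -S.f p) ⟨y, hy, by simpa using hyp⟩
    exact ⟨a, ha, exists_vertex_lt hx, b, by simpa using hb⟩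
  obtain ⟨a, rfl, ⟨b, hb⟩, b', hb'⟩ := key p ((Finset.mem_bipartiteBelow _).1 hp).2
  obtain ⟨c, rfl, ⟨d, hd⟩, d', hd'⟩ := key q ((Finset.mem_bipartiteBelow _).1 hq).2
  by_contra hne
  -- Suppose `a` and `c` were both middle vertices. The other two vertices lie on opposite sides of
  -- `a`, and `c` is one of them; a vertex beyond `c` would have to be the remaining one, which is
  -- on the wrong side.
  have two : ∀ k l m n : Fin 3, k ≠ l → m ≠ k → n ≠ k → m ≠ n → m = l ∨ n = l := by decide
  have third : ∀ k l m n : Fin 3, k ≠ l → m ≠ k → m ≠ l → n ≠ k → n ≠ l → m = n := by decide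
  have hac : a ≠ c := by rintro rfl; exact hne rfl
  have hba : b ≠ a := by rintro rfl; exact hb.false
  have hba' : b' ≠ a := by rintro rfl; exact hb'.false
  have hbb : b ≠ b' := by rintro rfl; exact (hb.trans hb').false
  rcases two a c b b' hac hba hba' hbb with rfl | rfl
  · obtain rfl := third a b d b' hac (by rintro rfl; linarith) (by rintro rfl; linarith) hba'
      hbb.symm
    linarith
  · obtain rfl := third a b' d' b hac (by rintro rfl; linarith) (by rintro rfl; linarith) hba hbb
    linarith

end ContactSystem

/-! ### Exposed points and the bound for general systems -/

/-- This lets strict maximality at `p` pass from the vertices to their convex hull. -/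
lemma convex_insert_halfSpace (g : Plane →ₗ[ℝ] ℝ) (p : Plane) :
    Convex ℝ {x : Plane | x ≠ p → g x < g p} := by
  intro x hx y hy a b ha hb hab hne
  have le : ∀ z, (z ≠ p → g z < g p) → g z ≤ g p := fun z hz => by
    rcases eq_or_ne z p with rfl | h
    · exact le_rfl
    · exact (hz h).le
  have hx' := le x hx
  have hy' := le y hy
  obtain rfl : a = 1 - b := by linarith
  simp only [map_add, map_smul, smul_eq_mul]
  rcases eq_or_ne x p with rfl | hxp
  · rcases eq_or_ne y x with rfl | hyx
    · exact absurd (by module) hne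
    · have h1 := hy hyx
      rcases hb.eq_or_lt with rfl | hb
      · simp at hne
      · nlinarith
  · have h1 := hx hxp
    rcases ha.eq_or_lt with h0 | ha
    · obtain rfl : b = 1 := by linarith
      have : y ≠ p := by rintro rfl; simp at hne
      have := hy this
      linarith
    · nlinarith

namespace ContactSystem

variable {ι : Type*} (S : ContactSystem ι)

/-- Otherwise all extreme points of the hull of the vertices lie on the line `h = c`. By
Krein–Milman so does the whole hull, which contains a solid triangle. -/
lemma exists_exposed_apply_ne (hW : S.W.Nonempty) {h : Plane →ₗ[ℝ] ℝ} (h0 : h ≠ 0) (c : ℝ) :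
    ∃ p, S.Exposed p ∧ (S.vert p).Nonempty ∧ h p ≠ c := by
  classical
  set F : Set Plane := ⋃ i ∈ S.W, Set.range (S.T i).points with hF
  have hfin : F.Finite := S.W.finite_toSet.biUnion fun i _ => Set.finite_range _
  have hcomp : IsCompact (convexHull ℝ F) := hfin.isCompact_convexHull ℝ
  have hsub : ∀ i ∈ S.W, region (S.T i) ⊆ convexHull ℝ F := fun i hi =>
    convexHull_mono (Set.subset_biUnion_of_mem (u := fun i => Set.range (S.T i).points) hi)
  have hEF : (convexHull ℝ F).extremePoints ℝ ⊆ F := extremePoints_convexHull_subset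
  by_contra! hcon
  have hE : ∀ p ∈ (convexHull ℝ F).extremePoints ℝ, h p = c := by
    intro p hp
    apply hcon
    · have hp' := (convex_convexHull ℝ F).mem_extremePoints_iff_convex_sdiff.1 hp
      have hdiff : convexHull ℝ (F \ {p}) ⊆ convexHull ℝ F \ {p} :=
        convexHull_min (Set.sdiff_subset_sdiff_left (subset_convexHull ℝ F)) hp'.2
      obtain ⟨g, u, hgp, hg⟩ := geometric_hahn_banach_point_closed
        (convex_convexHull ℝ (F \ {p})) ((hfin.sdiff).isClosed_convexHull ℝ)
        (fun hmem => (hdiff hmem).2 rfl)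
      refine ⟨-(g : Plane →ₗ[ℝ] ℝ), fun i hi x hx => ?_⟩
      have hmem : x ∈ {x : Plane | x ≠ p →
          (-(g : Plane →ₗ[ℝ] ℝ)) x < (-(g : Plane →ₗ[ℝ] ℝ)) p} :=
        convexHull_min (fun y hy hyp => by
          have := hg y (subset_convexHull ℝ _ ⟨hy, hyp⟩)
          simp only [LinearMap.neg_apply, ContinuousLinearMap.coe_coe]
          linarith) (convex_insert_halfSpace _ p) (hsub i hi hx)
      exact hmem
    · obtain ⟨i, hi, hpi⟩ := Set.mem_iUnion₂.1 (hEF hp)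
      exact ⟨i, S.mem_vert.2 ⟨hi, hpi⟩⟩
  have hline : convexHull ℝ F ⊆ {z | h z = c} := by
    rw [← closure_convexHull_extremePoints hcomp (convex_convexHull ℝ F)]
    exact closure_minimal (convexHull_min hE (convex_hyperplane h.isLinear c))
      (isClosed_eq h.continuous_of_finiteDimensional continuous_const)
  obtain ⟨i, hi⟩ := hW
  obtain ⟨x, hx, hxc⟩ := (isBody_region (S.T i)).solid h h0 c
  exact hxc (hline (hsub i hi hx))

lemma exists_three_exposed (hW : S.W.Nonempty) : ∃ Q ⊆ S.nodes, Q.card = 3 ∧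
    ∀ p ∈ Q, S.Exposed p ∧ (S.vert p).Nonempty := by
  classical
  have n0 : functional 1 0 ≠ 0 := by simp [functional_ne_zero_iff]
  obtain ⟨a, ha, ha', -⟩ := S.exists_exposed_apply_ne hW n0 0
  obtain ⟨b, hb, hb', hab⟩ := S.exists_exposed_apply_ne hW n0 (functional 1 0 a)
  have hba : b ≠ a := by rintro rfl; exact hab rfl
  obtain ⟨h, h0, hv⟩ := exists_functional_vanishing (sub_ne_zero.2 hba)
  -- The third point avoids the line through `a` and `b`, on which `h` is constant.
  obtain ⟨c, hc, hc', hac⟩ := S.exists_exposed_apply_ne hW h0 (h a)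
  rw [map_sub, sub_eq_zero] at hv
  have hca : c ≠ a := by rintro rfl; exact hac rfl
  have hcb : c ≠ b := by rintro rfl; exact hac hv
  have hQ : ∀ p ∈ ({a, b, c} : Finset Plane), S.Exposed p ∧ (S.vert p).Nonempty := by
    simp only [Finset.mem_insert, Finset.mem_singleton]
    rintro p (rfl | rfl | rfl)
    exacts [⟨ha, ha'⟩, ⟨hb, hb'⟩, ⟨hc, hc'⟩]
  refine ⟨{a, b, c}, fun p hp => ?_, Finset.card_eq_three.2 ⟨a, b, c, hba.symm, hca.symm, hcb.symm, rfl⟩, hQ⟩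
  obtain ⟨i, hi⟩ := (hQ p hp).2
  exact S.mem_nodes_of_vertex (S.mem_vert.1 hi).1 (S.mem_vert.1 hi).2

lemma sum_add_three_le {s : Finset Plane} {Q : Finset Plane} (hQ : Q ⊆ s) (hQ3 : Q.card = 3)
    {a b : Plane → ℕ} (h : ∀ p ∈ s, a p ≤ b p) (h' : ∀ p ∈ Q, a p + 1 ≤ b p) :
    ∑ p ∈ s, a p + 3 ≤ ∑ p ∈ s, b p := by
  classical
  rw [← Finset.sum_sdiff hQ, ← Finset.sum_sdiff hQ, add_assoc]
  refine add_le_add (Finset.sum_le_sum fun p hp => h p (Finset.mem_sdiff.1 hp).1) ?_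
  have := Finset.sum_le_sum h'
  rwa [Finset.sum_add_distrib, Finset.sum_const, hQ3] at this

/-- A system of `n ≥ 1` triangles has at most `2 n - 2` contacts. -/
theorem two_mul_card_add_three_le (hW : S.W.Nonempty) : 2 * S.K.card + 3 ≤ 4 * S.W.card := by
  obtain ⟨Q, hQ, hQ3, hQe⟩ := S.exists_three_exposed hW
  have h := sum_add_three_le hQ hQ3 (fun p _ => S.card_ends_le_add_mid p) fun p hp =>
    ((hQe p hp).1.card_ends_lt (hQe p hp).2).trans (Nat.le_add_right _ _)
  rw [S.sum_card_ends, Finset.sum_add_distrib, S.sum_card_vert] at h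
  have := S.sum_card_mid_le
  omega

end ContactSystem

/-! ### Directions of the contacts at a point of a triangle -/

lemma exists_cone_of_mem_region {T : Affine.Triangle ℝ Plane} (a : Fin 3) {q : Plane}
    (hq : q ∈ region T) : ∃ s t : ℝ, 0 ≤ s ∧ 0 ≤ t ∧
      q = T.points a + s • (T.points (a + 1) - T.points a) +
        t • (T.points (a + 2) - T.points a) := by
  have hconv : Convex ℝ {q : Plane | ∃ s t : ℝ, 0 ≤ s ∧ 0 ≤ t ∧
      q = T.points a + s • (T.points (a + 1) - T.points a) +
        t • (T.points (a + 2) - T.points a)} := by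
    rintro _ ⟨s, t, hs, ht, rfl⟩ _ ⟨s', t', hs', ht', rfl⟩ x y hx hy hxy
    refine ⟨x * s + y * s', x * t + y * t', by positivity, by positivity, ?_⟩
    obtain rfl : x = 1 - y := by linarith
    module
  refine convexHull_min ?_ hconv hq
  rintro _ ⟨b, rfl⟩
  have : ∀ a b : Fin 3, b = a ∨ b = a + 1 ∨ b = a + 2 := by decide
  rcases this a b with rfl | rfl | rfl
  · exact ⟨0, 0, le_rfl, le_rfl, by simp⟩
  · exact ⟨1, 0, zero_le_one, le_rfl, by simp⟩
  · exact ⟨0, 1, le_rfl, zero_le_one, by simp⟩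

/-- At each of its points a triangle has only two directions along which contacts can start. -/
lemma exists_boundary_directions (T : Affine.Triangle ℝ Plane) {p : Plane} (hp : p ∈ region T) :
    ∃ d : Bool → Plane, (∀ k, d k ≠ 0) ∧ ∀ Y : Set Plane, Separated (region T) Y → p ∈ Y →
      ∀ q ∈ region T ∩ Y, q ≠ p → ∃ k, ∃ ε : ℝ, 0 < ε ∧ q = p + ε • d k := by
  by_cases hv : p ∈ Set.range T.points
  · obtain ⟨a, rfl⟩ := hv
    have h3 : ∀ a : Fin 3, a + 1 ≠ a ∧ a + 2 ≠ a := by decide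
    refine ⟨fun k => cond k (T.points (a + 1) - T.points a) (T.points (a + 2) - T.points a),
      ?_, ?_⟩
    · rintro (_ | _)
      · exact sub_ne_zero.2 (T.independent.injective.ne (h3 a).2)
      · exact sub_ne_zero.2 (T.independent.injective.ne (h3 a).1)
    · rintro Y ⟨h, c, h0, hT, hY⟩ hpY q ⟨hqT, hqY⟩ hqp
      have hpc : h (T.points a) = c := le_antisymm (hT _ hp) (hY _ hpY)
      have hqc : h q = c := le_antisymm (hT _ hqT) (hY _ hqY)
      have hb := hT _ (subset_convexHull ℝ _ ⟨a + 1, rfl⟩)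
      have hc := hT _ (subset_convexHull ℝ _ ⟨a + 2, rfl⟩)
      obtain ⟨s, t, hs, ht, rfl⟩ := exists_cone_of_mem_region a hqT
      rcases hs.eq_or_lt with rfl | hs
      · rcases ht.eq_or_lt with rfl | ht
        · simp at hqp
        · exact ⟨false, t, ht, by simp⟩
      rcases ht.eq_or_lt with rfl | ht
      · exact ⟨true, s, hs, by simp⟩
      -- With both coefficients positive, the separating functional would be constant on the
      -- triangle.
      exfalso
      simp only [map_add, map_smul, map_sub, smul_eq_mul] at hqc
      have e1 : h (T.points (a + 1)) = c := le_antisymm hb (by nlinarith)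
      have e2 : h (T.points (a + 2)) = c := le_antisymm hc (by nlinarith)
      obtain ⟨x, hx, hxc⟩ := (isBody_region T).solid h h0 c
      obtain ⟨s', t', -, -, rfl⟩ := exists_cone_of_mem_region a hx
      exact hxc (by simp [e1, e2, hpc])
  · obtain ⟨a, ha, b, hb, hab, hpab⟩ := isFlat_of_notMem_vertices hp hv
    refine ⟨fun k => cond k (b - a) (a - b), ?_, ?_⟩
    · rintro (_ | _)
      · exact sub_ne_zero.2 hab
      · exact sub_ne_zero.2 hab.symm
    · rintro Y ⟨h, c, h0, hT, hY⟩ hpY q ⟨hqT, hqY⟩ hqp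
      have hpc : h p = c := le_antisymm (hT _ hp) (hY _ hpY)
      have hqc : h q = c := le_antisymm (hT _ hqT) (hY _ hqY)
      have hd := eq_of_mem_openSegment hT ha hb hpab hpc
      obtain ⟨t, ht⟩ := exists_vector_eq_smul h0 (sub_ne_zero.2 hab.symm) hd
        (show h (q - p) = 0 by rw [map_sub, hqc, hpc, sub_self])
      rcases lt_trichotomy t 0 with h1 | rfl | h1
      · refine ⟨false, -t, by linarith, ?_⟩
        rw [← add_sub_cancel p q, ht]
        simp only [cond_false]
        module
      · rw [zero_smul, sub_eq_zero] at ht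
        exact absurd ht hqp
      · refine ⟨true, t, h1, ?_⟩
        rw [← add_sub_cancel p q, ht]
        simp

/-- Three bodies cannot have contacts with one triangle that start at the same point. -/
lemma not_three_contacts {ι : Type*} {T : ι → Affine.Triangle ℝ Plane}
    (hS : ∀ i j, i ≠ j → Separated (region (T i)) (region (T j))) {a : ι} {p : Plane}
    (hp : p ∈ region (T a)) {i : Fin 3 → ι} (hi : Function.Injective i) (hia : ∀ k, i k ≠ a)
    (hpi : ∀ k, p ∈ region (T (i k))) (hq : ∀ k, ∃ q ∈ region (T a) ∩ region (T (i k)), q ≠ p) :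
    False := by
  obtain ⟨d, d0, hd⟩ := exists_boundary_directions (T a) hp
  have key : ∀ k, ∃ b, ∃ ε : ℝ, 0 < ε ∧ p + ε • d b ∈ region (T a) ∩ region (T (i k)) := by
    intro k
    obtain ⟨q, hq, hqp⟩ := hq k
    obtain ⟨b, ε, h0, rfl⟩ := hd _ (hS _ _ (hia k).symm) (hpi k) q hq hqp
    exact ⟨b, ε, h0, hq⟩
  choose b ε h0 hε using key
  -- Two of the three contacts leave in the same direction, so their bodies and `T a` share a
  -- segment.
  obtain ⟨k, l, hkl, hb⟩ := Fintype.exists_ne_map_eq_of_card_lt b (by simp)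
  have m0 := lt_min (h0 k) (h0 l)
  have hl := hε l
  rw [← hb] at hl
  refine not_three_share (isBody_region (T a)) (isBody_region (T (i k))) (isBody_region (T (i l)))
    (hS _ _ (hia k).symm) (hS _ _ (hia l).symm) (hS _ _ (hi.ne hkl)) (a := p)
    (b := p + min (ε k) (ε l) • d (b k)) ?_ hp
    (mem_of_le (convex_region _) hp m0.le (min_le_left _ _) (hε k).1) (hpi k)
    (mem_of_le (convex_region _) (hpi k) m0.le (min_le_left _ _) (hε k).2) (hpi l)
    (mem_of_le (convex_region _) (hpi l) m0.le (min_le_right _ _) hl.2)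
  intro h
  rcases smul_eq_zero.1 (left_eq_add.1 h) with h1 | h1
  · exact m0.ne' h1
  · exact d0 _ h1

/-! ### The bipartite system of two triangles and their common neighbours -/

namespace ContactSystem

variable {ι : Type*} (S : ContactSystem ι)

open Classical in
/-- The triangles whose contact with `S.T a`, listed as `(a, _)`, ends at `p`. -/
noncomputable def partners (a : ι) (N : Finset ι) (p : Plane) : Finset ι :=
  N.filter fun i => (a, i) ∈ S.ends p

lemma mem_partners {a i : ι} {N : Finset ι} {p : Plane} :
    i ∈ S.partners a N p ↔ i ∈ N ∧ (a, i) ∈ S.ends p := by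
  simp [partners]

lemma card_partners_le_two (a : ι) (N : Finset ι) (p : Plane) :
    (S.partners a N p).card ≤ 2 := by
  classical
  by_contra! h
  obtain ⟨i, hi, hinj⟩ : ∃ i : Fin 3 → ι, (∀ k, i k ∈ S.partners a N p) ∧ i.Injective := by
    obtain ⟨x, hx, y, hy, z, hz, hxy, hxz, hyz⟩ := Finset.two_lt_card.1 h
    refine ⟨![x, y, z], ?_, ?_⟩
    · intro k
      fin_cases k <;> simpa
    · intro k l
      fin_cases k <;> fin_cases l <;> simp [hxy, hxz, hyz, hxy.symm, hxz.symm, hyz.symm]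
  have hmem := fun k => (S.mem_partners.1 (hi k)).2
  exact not_three_contacts S.separated (S.mem_inter_of_mem_ends (hmem 0)).1 hinj
    (fun k => (S.ne_of_mem (S.mem_ends.1 (hmem k)).1).symm)
    (fun k => (S.mem_inter_of_mem_ends (hmem k)).2) (fun k => S.exists_ne_of_mem_ends (hmem k))

section Bipartite

variable [DecidableEq ι] {u v : ι} {N : Finset ι}

/-- At most one triangle through `p` has no vertex there. Besides `A ∪ B`, one of `u`, `v` passes
through `p`, and both do if `A ∩ B` is nonempty. So the ends, at most `|A ∪ B| + |A ∩ B|`, number at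
most the vertices if `A ∩ B` is empty, and otherwise at most the vertices plus `|A ∩ B| - 1`, where
`|A ∩ B| ≤ 2`. -/
lemma card_ends_le_of_bipartite (huv : u ≠ v) (hu : u ∉ N) (hv : v ∉ N)
    (hK : S.K = {u, v} ×ˢ N) (p : Plane) :
    (S.ends p).card ≤ (S.vert p).card +
      if 2 ≤ (S.partners u N p ∩ S.partners v N p).card then 1 else 0 := by
  rcases (S.ends p).eq_empty_or_nonempty with h0 | ⟨e₀, he₀⟩
  · simp [h0]
  have hflat := S.card_flat_le_one he₀
  set A := S.partners u N p with hA
  set B := S.partners v N p with hB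
  have hends : (S.ends p).card ≤ A.card + B.card := by
    have hsub : S.ends p ⊆ A.image (Prod.mk u) ∪ B.image (Prod.mk v) := by
      rintro ⟨a, i⟩ he
      have hm := (S.mem_ends.1 he).1
      rw [hK, Finset.mem_product, Finset.mem_insert, Finset.mem_singleton] at hm
      rw [Finset.mem_union]
      rcases hm with ⟨h | h, hi⟩
      · dsimp only at h
        subst h
        exact Or.inl (Finset.mem_image_of_mem _ (S.mem_partners.2 ⟨hi, he⟩))
      · dsimp only at h
        subst h
        exact Or.inr (Finset.mem_image_of_mem _ (S.mem_partners.2 ⟨hi, he⟩))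
    exact (Finset.card_le_card hsub).trans ((Finset.card_union_le _ _).trans
      (add_le_add Finset.card_image_le Finset.card_image_le))
  have hAB := Finset.card_union_add_card_inter A B
  have h2 : (A ∩ B).card ≤ 2 :=
    (Finset.card_le_card Finset.inter_subset_left).trans (S.card_partners_le_two u N p)
  have hthrough : ∀ M : Finset ι, (∀ i ∈ M, i ∈ S.W ∧ p ∈ region (S.T i)) →
      M.card ≤ (S.vert p).card + 1 := by
    intro M hM
    have hsub : M ⊆ S.vert p ∪ S.flat p := by
      intro i hi
      obtain ⟨h1, h2⟩ := hM i hi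
      rw [Finset.mem_union, mem_vert, mem_flat]
      by_cases hv : p ∈ Set.range (S.T i).points
      · exact Or.inl ⟨h1, hv⟩
      · exact Or.inr ⟨h1, h2, hv⟩
    have := (Finset.card_le_card hsub).trans (Finset.card_union_le _ _)
    omega
  have hmem : ∀ {a i}, (a, i) ∈ S.ends p →
      (a ∈ S.W ∧ p ∈ region (S.T a)) ∧ (i ∈ S.W ∧ p ∈ region (S.T i)) := by
    intro a i h
    have h1 := S.mem_inter_of_mem_ends h
    have h2 := S.mem_W _ (S.mem_ends.1 h).1
    exact ⟨⟨h2.1, h1.1⟩, ⟨h2.2, h1.2⟩⟩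
  have hun : ∀ i ∈ A ∪ B, i ∈ N ∧ i ∈ S.W ∧ p ∈ region (S.T i) := by
    intro i hi
    rcases Finset.mem_union.1 hi with h | h
    · exact ⟨(S.mem_partners.1 h).1, (hmem (S.mem_partners.1 h).2).2⟩
    · exact ⟨(S.mem_partners.1 h).1, (hmem (S.mem_partners.1 h).2).2⟩
  have huAB : u ∉ A ∪ B := fun h => hu (hun u h).1
  have hvAB : v ∉ A ∪ B := fun h => hv (hun v h).1
  rcases (A ∩ B).eq_empty_or_nonempty with hemp | ⟨i, hi⟩
  · rw [hemp, Finset.card_empty] at hAB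
    obtain ⟨w, hw, hwN⟩ : ∃ w, (w ∈ S.W ∧ p ∈ region (S.T w)) ∧ w ∉ A ∪ B := by
      have hm := (S.mem_ends.1 he₀).1
      rw [hK, Finset.mem_product, Finset.mem_insert, Finset.mem_singleton] at hm
      refine ⟨e₀.1, (hmem he₀).1, ?_⟩
      rcases hm.1 with h | h <;> rwa [h]
    have := hthrough (insert w (A ∪ B)) fun i hi => by
      rcases Finset.mem_insert.1 hi with rfl | h
      · exact hw
      · exact (hun i h).2
    rw [Finset.card_insert_of_notMem hwN] at this
    omega
  · obtain ⟨hiA, hiB⟩ := Finset.mem_inter.1 hi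
    have := hthrough (insert u (insert v (A ∪ B))) fun i hi => by
      rw [Finset.mem_insert, Finset.mem_insert] at hi
      rcases hi with rfl | rfl | h
      · exact (hmem (S.mem_partners.1 hiA).2).1
      · exact (hmem (S.mem_partners.1 hiB).2).1
      · exact (hun i h).2
    rw [Finset.card_insert_of_notMem (by
      rw [Finset.mem_insert]; exact fun h => h.elim huv huAB),
      Finset.card_insert_of_notMem hvAB] at this
    split_ifs <;> omega

/-- If `p ≠ q`, the triangles of `u` and `v` share both points. Then `u` meets two common partners
and also `v` beyond `p`, contrary to `not_three_contacts`. -/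
lemma eq_of_two_le_card_inter (huv : u ≠ v) (hv : v ∉ N) {p q : Plane}
    (hp : 2 ≤ (S.partners u N p ∩ S.partners v N p).card)
    (hq : 2 ≤ (S.partners u N q ∩ S.partners v N q).card) : p = q := by
  by_contra hpq
  obtain ⟨i, hi, j, hj, hij⟩ := Finset.one_lt_card.1 hp
  obtain ⟨k, hk⟩ := Finset.card_pos.1 (Nat.zero_lt_two.trans_le hq)
  simp only [Finset.mem_inter, mem_partners] at hi hj hk
  have hiu := S.mem_inter_of_mem_ends hi.1.2
  have hju := S.mem_inter_of_mem_ends hj.1.2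
  have hiv := S.mem_inter_of_mem_ends hi.2.2
  have hku := S.mem_inter_of_mem_ends hk.1.2
  have hkv := S.mem_inter_of_mem_ends hk.2.2
  have niv : i ≠ v := by rintro rfl; exact hv hi.1.1
  have njv : j ≠ v := by rintro rfl; exact hv hj.1.1
  refine not_three_contacts S.separated (a := u) (p := p) hiu.1 (i := ![i, j, v]) ?_ ?_ ?_ ?_
  · intro k l
    fin_cases k <;> fin_cases l <;> simp [hij, niv, njv, hij.symm, niv.symm, njv.symm]
  · intro k
    fin_cases k
    · exact (S.ne_of_mem (S.mem_ends.1 hi.1.2).1).symm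
    · exact (S.ne_of_mem (S.mem_ends.1 hj.1.2).1).symm
    · exact huv.symm
  · intro k
    fin_cases k
    · exact hiu.2
    · exact hju.2
    · exact hiv.1
  · intro k
    fin_cases k
    · exact S.exists_ne_of_mem_ends hi.1.2
    · exact S.exists_ne_of_mem_ends hj.1.2
    · exact ⟨q, ⟨hku.1, hkv.1⟩, fun h => hpq h.symm⟩

/-- Two triangles have at most four common neighbours. -/
theorem card_le_four_of_bipartite (huv : u ≠ v) (hu : u ∉ N) (hv : v ∉ N)
    (hK : S.K = {u, v} ×ˢ N) (hW : S.W = insert u (insert v N)) : N.card ≤ 4 := by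
  obtain ⟨Q, hQ, hQ3, hQe⟩ := S.exists_three_exposed (by rw [hW]; exact Finset.insert_nonempty _ _)
  have h := sum_add_three_le hQ hQ3
    (fun p _ => S.card_ends_le_of_bipartite huv hu hv hK p) fun p hp =>
    ((hQe p hp).1.card_ends_lt (hQe p hp).2).trans (Nat.le_add_right _ _)
  rw [S.sum_card_ends, Finset.sum_add_distrib, S.sum_card_vert, Finset.sum_boole] at h
  have h1 : (S.nodes.filter fun p =>
      2 ≤ (S.partners u N p ∩ S.partners v N p).card).card ≤ 1 :=
    Finset.card_le_one.2 fun p hp q hq => S.eq_of_two_le_card_inter huv hv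
      (Finset.mem_filter.1 hp).2 (Finset.mem_filter.1 hq).2
  have h2 : S.K.card = 2 * N.card := by
    rw [hK, Finset.card_product, Finset.card_pair huv]
  have h3 : S.W.card = N.card + 2 := by
    rw [hW, Finset.card_insert_of_notMem, Finset.card_insert_of_notMem hv]
    rw [Finset.mem_insert]
    exact fun h => h.elim huv hu
  rw [h2, h3, Nat.cast_id] at h
  omega

end Bipartite

end ContactSystem

/-! ### From representations to contact systems -/

lemma side_subset_region (T : Affine.Triangle ℝ Plane) (i : Fin 3) : side T i ⊆ region T :=
  segment_subset_convexHull ⟨i, rfl⟩ ⟨i + 1, rfl⟩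

lemma Touch.exists_ne {A B : Affine.Triangle ℝ Plane} (h : Touch A B) :
    ∃ a b, a ≠ b ∧ a ∈ region A ∩ region B ∧ b ∈ region A ∩ region B := by
  obtain ⟨i, j, p, q, hpq, hsub⟩ := h
  have hs : side A i ∩ side B j ⊆ region A ∩ region B :=
    Set.inter_subset_inter (side_subset_region A i) (side_subset_region B j)
  exact ⟨p, q, hpq, hs (hsub (left_mem_segment ℝ p q)), hs (hsub (right_mem_segment ℝ p q))⟩

lemma IsRepresentation.exists_contactSystem {V : Type*} {G : SimpleGraph V}
    {T : V → Affine.Triangle ℝ Plane} (hT : IsRepresentation G T) (W : Finset V)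
    (K : Finset (V × V)) (hW : ∀ e ∈ K, e.1 ∈ W ∧ e.2 ∈ W)
    (hasymm : ∀ i j, (i, j) ∈ K → (j, i) ∉ K) (hK : ∀ e ∈ K, G.Adj e.1 e.2) :
    ∃ S : ContactSystem V, S.T = T ∧ S.W = W ∧ S.K = K :=
  TouchingTriangles.exists_contactSystem T W K
    (fun i j hij => separated_region (hT.disjoint_interior i j hij)) hW hasymm
    fun e he => ((hT.adj_iff_touch _ _ (hK e he).ne).1 (hK e he)).exists_ne

/-- The edges of a finite induced subgraph can be listed as ordered pairs. -/
lemma exists_orientation {V : Type*} [Finite V] (G : SimpleGraph V) (s : Set V) :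
    ∃ K : Finset (V × V), (K.card : ℕ∞) = (G.induce s).edgeSet.encard ∧
      (∀ e ∈ K, e.1 ∈ s ∧ e.2 ∈ s ∧ G.Adj e.1 e.2) ∧ ∀ i j, (i, j) ∈ K → (j, i) ∉ K := by
  classical
  have hfin : (G.induce s).edgeSet.Finite := Set.toFinite _
  -- One ordered representative per unordered pair; both orders could only come from the same pair,
  -- which would be a loop.
  let φ : Sym2 s → V × V := fun e => ((Quot.out e).1.1, (Quot.out e).2.1)
  have hφ : ∀ e : Sym2 s, Sym2.mk (Quot.out e).1 (Quot.out e).2 = e := fun e => Quot.out_eq e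
  have hinj : Function.Injective φ := by
    intro e e' h
    rw [← hφ e, ← hφ e', Subtype.ext (Prod.ext_iff.1 h).1, Subtype.ext (Prod.ext_iff.1 h).2]
  have hadj : ∀ e ∈ (G.induce s).edgeSet, G.Adj (φ e).1 (φ e).2 := by
    intro e he
    rw [← hφ e, SimpleGraph.mem_edgeSet] at he
    exact he
  refine ⟨hfin.toFinset.image φ, ?_, ?_, ?_⟩
  · rw [Finset.card_image_of_injective _ hinj, hfin.encard_eq_coe_toFinset_card]
  · intro e he
    obtain ⟨e, he', rfl⟩ := Finset.mem_image.1 he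
    exact ⟨(Quot.out e).1.2, (Quot.out e).2.2, hadj e (hfin.mem_toFinset.1 he')⟩
  · intro i j h h'
    obtain ⟨e, he, hij⟩ := Finset.mem_image.1 h
    obtain ⟨e', he', hji⟩ := Finset.mem_image.1 h'
    have hadj' := hadj e (hfin.mem_toFinset.1 he)
    have e1 := Prod.ext_iff.1 hij
    have e2 := Prod.ext_iff.1 hji
    have : e = e' := by
      rw [← hφ e, ← hφ e', Sym2.eq_swap, Subtype.ext (e1.2.trans e2.1.symm),
        Subtype.ext (e1.1.trans e2.2.symm)]
    subst this
    exact hadj'.ne (e1.1.trans e2.2.symm)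

end TouchingTriangles

theorem mainTheorem5 {V : Type*} [Finite V] (G : SimpleGraph V)
    (hG : TouchingTriangles.IsTouchingTriangleGraph G) (u v : V) (huv : u ≠ v) :
    (G.commonNeighbors u v).encard ≤ 4 ∧
      (G.induce (G.commonNeighbors u v)).edgeSet.encard ≤ 2 := by
  classical
  obtain ⟨T, hT⟩ := hG
  have hfin : (G.commonNeighbors u v).Finite := Set.toFinite _
  set N := hfin.toFinset with hN
  have hmem : ∀ i, i ∈ N ↔ G.Adj u i ∧ G.Adj v i := fun i => by
    rw [hN, hfin.mem_toFinset, SimpleGraph.mem_commonNeighbors]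
  have hu : u ∉ N := fun h => ((hmem u).1 h).1.ne rfl
  have hv : v ∉ N := fun h => ((hmem v).1 h).2.ne rfl
  have hK : ∀ e ∈ ({u, v} : Finset V) ×ˢ N, (e.1 = u ∨ e.1 = v) ∧ e.2 ∈ N := fun e he => by
    simpa using he
  have hKadj : ∀ e ∈ ({u, v} : Finset V) ×ˢ N, G.Adj e.1 e.2 := by
    intro e he
    obtain ⟨h | h, h2⟩ := hK e he
    · rw [h]; exact ((hmem _).1 h2).1
    · rw [h]; exact ((hmem _).1 h2).2
  have hKN : ∀ e ∈ ({u, v} : Finset V) ×ˢ N, e.1 ∉ N := by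
    intro e he
    rcases (hK e he).1 with h | h <;> rwa [h]
  have hKW : ∀ e ∈ ({u, v} : Finset V) ×ˢ N,
      e.1 ∈ insert u (insert v N) ∧ e.2 ∈ insert u (insert v N) := by
    intro e he
    obtain ⟨h1, h2⟩ := hK e he
    simp only [Finset.mem_insert]
    exact ⟨by tauto, Or.inr (Or.inr h2)⟩
  constructor
  · obtain ⟨S, -, hSW, hSK⟩ := hT.exists_contactSystem (insert u (insert v N)) ({u, v} ×ˢ N) hKW
      (fun i j h h' => hKN _ h' (hK _ h).2) hKadj
    rw [hfin.encard_eq_coe_toFinset_card]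
    exact_mod_cast S.card_le_four_of_bipartite huv hu hv hSK hSW
  · obtain ⟨E, hE, hEadj, hEasymm⟩ :=
      TouchingTriangles.exists_orientation G (G.commonNeighbors u v)
    have hEN : ∀ e ∈ E, e.1 ∈ N ∧ e.2 ∈ N := fun e he =>
      ⟨hfin.mem_toFinset.2 (hEadj e he).1, hfin.mem_toFinset.2 (hEadj e he).2.1⟩
    obtain ⟨S, -, hSW, hSK⟩ := hT.exists_contactSystem (insert u (insert v N)) ({u, v} ×ˢ N ∪ E)
      (fun e he => (Finset.mem_union.1 he).elim (hKW e) fun h => by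
        have := hEN e h
        simp only [Finset.mem_insert]
        tauto)
      (fun i j h h' => by
        rcases Finset.mem_union.1 h with h | h <;> rcases Finset.mem_union.1 h' with h' | h'
        · exact hKN _ h' (hK _ h).2
        · exact hKN _ h (hEN _ h').2
        · exact hKN _ h' (hEN _ h).2
        · exact hEasymm _ _ h h')
      (fun e he => (Finset.mem_union.1 he).elim (hKadj e) fun h => (hEadj e h).2.2)
    have hcard := S.two_mul_card_add_three_le (by rw [hSW]; exact Finset.insert_nonempty _ _)
    have hdisj : Disjoint (({u, v} : Finset V) ×ˢ N) E :=
      Finset.disjoint_left.2 fun e he he' => hKN e he (hEN e he').1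
    rw [hSK, hSW, Finset.card_union_of_disjoint hdisj, Finset.card_product, Finset.card_pair huv,
      Finset.card_insert_of_notMem, Finset.card_insert_of_notMem hv] at hcard
    · rw [← hE]
      -- From `2(2|N| + |E|) + 3 ≤ 4(|N| + 2)`, that is, `2|E| ≤ 5`.
      have : E.card ≤ 2 := by omega
      exact_mod_cast this
    · rw [Finset.mem_insert]
      exact fun h => h.elim huv hu
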